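/- Let $p$ be an odd prime, let $g$ be a prime number that is a primitive root modulo $p^2$, and put $q=g^{p-1}$. Let $r\ge 1$ and $e\ge 0$ be integers. For a prime power $Q$ and $n\ge 1$ let $\mathrm{L}_n^*(\mathbf F_Q)$ be the poset of nonzero proper linear subspaces of $\mathbf F_Q^n$, with its action of $\mathrm{GL}_n(\mathbf F_Q)$, and let $$\widetilde\chi_r^p(n,Q)=\frac{1}{|\mathrm{GL}_n(\mathbf F_Q)|}\sum_{X\in \mathrm{Hom}(\mathbf Z\times\mathbf Z_p^{\,r-1},\,\mathrm{GL}_n(\mathbf F_Q))}\widetilde\chi\big(C_{\mathrm{L}_n^*(\mathbf F_Q)}(X(\mathbf Z\times\mathbf Z_p^{\,r-1}))\big),$$ where $\mathbf Z_p$ is the group of $p$-adic integers, $C_{\mathrm{L}_n^*(\mathbf F_Q)}(H)$ is the subposet of the $H$-invariant subspaces, and $\widetilde\chi$ is the reduced Euler characteristic of the order complex of a finite poset (so $\widetilde\chi(\emptyset)=-1$). Let $$F_r^p(x)(Q)=1+\sum_{n\ge 1}\widetilde\chi_r^p(n,Q)\,x^n .$$ Write $m_p=p^{\nu_p(m)}$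 for the $p$-part of a positive integer $m$. Then $$F^p_r(x)(q^{p^e})=F^p_r(x)(q)^{p^{(r-1)e}}=\exp\Big(-\sum_{n\ge 1}\big((q^{p^e})^n-1\big)_p^{\,r-1}\,\frac{x^n}{n}\Big)=\prod_{n\ge 0}\Big(\frac{(1-x^{p^n})^p}{1-x^{p^{n+1}}}\Big)^{p^{(r-2)(n+1)+(r-1)e}}$$ as formal power series, where the infinite product converges coefficientwise and powers with a non-integral rational exponent $a$ (which occur only for $r=1$) are formed in $\mathbf Q[[x]]$ by $f^a=\sum_{k\ge 0}\binom{a}{k}(f-1)^k$ for $f$ with constant term $1$. Moreover, for all $n\ge 1$ the number $\widetilde\chi_r^p(n,q^{p^e})$ is an integer divisible by $p^{(r-1)(1+e)}$. -/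

import Mathlib

noncomputable section

/-- The reduced Euler characteristic of (the order complex of) a finite poset: the alternating
sum `∑ (-1) ^ (dim c)` over all chains `c`, the empty chain (of dimension `-1`) included. -/
def reducedEulerChar (P : Type*) [PartialOrder P] : ℤ :=
  ∑ᶠ c : {c : Finset P // IsChain (· ≤ ·) (c : Set P)}, (-1 : ℤ) ^ (c.1.card + 1)

/-- The poset of the nonzero proper linear subspaces of `F ^ n` that are fixed by all elements of
a set `S ⊆ GL_n(F)`. -/
def fixedProperSubspaces (F : Type*) [Field F] (n : ℕ) (S : Set (GL (Fin n) F)) :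
    Set (Submodule F (Fin n → F)) :=
  {W | W ≠ ⊥ ∧ W ≠ ⊤ ∧
    ∀ g ∈ S, W.map (Matrix.mulVecLin (g : Matrix (Fin n) (Fin n) F)) = W}

/-- The group homomorphisms `ℤ × ℤ_p ^ (r - 1) → G`. -/
abbrev PrimaryHom (p : ℕ) [Fact p.Prime] (r : ℕ) (G : Type*) [Group G] : Type _ :=
  Multiplicative (ℤ × (Fin (r - 1) → ℤ_[p])) →* G

/-- There are only finitely many homomorphisms from `ℤ × ℤ_p ^ (r - 1)` to a finite group, so the
sum below is a genuine finite sum. -/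
theorem finite_primaryHom (p : ℕ) [Fact p.Prime] (r : ℕ) (G : Type*) [Group G] [Finite G] :
    Finite (PrimaryHom p r G) := by
  classical
  let Φ : PrimaryHom p r G → G × (Fin (r - 1) → G) := fun f =>
    (f (Multiplicative.ofAdd (1, 0)), fun i => f (Multiplicative.ofAdd (0, Pi.single i 1)))
  refine Finite.of_injective Φ ?_
  intro f g hfg
  have h1 : f (Multiplicative.ofAdd (1, 0)) = g (Multiplicative.ofAdd (1, 0)) :=
    congrArg Prod.fst hfg
  have h2 : ∀ i, f (Multiplicative.ofAdd (0, Pi.single i 1)) =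
      g (Multiplicative.ofAdd (0, Pi.single i 1)) := fun i => congrFun (congrArg Prod.snd hfg) i
  let H : AddSubgroup (ℤ × (Fin (r - 1) → ℤ_[p])) := Subgroup.toAddSubgroup' (f.eqLocus g)
  have hH : ∀ a, a ∈ H ↔ f (Multiplicative.ofAdd a) = g (Multiplicative.ofAdd a) :=
    fun a => Iff.rfl
  have hkill : ∀ a, Nat.card G • a ∈ H := by
    intro a
    rw [hH, ofAdd_nsmul, map_pow, map_pow, pow_card_eq_one', pow_card_eq_one']
  have hm : (Nat.card G : ℤ_[p]) ≠ 0 := by exact_mod_cast Nat.card_pos.ne'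
  have hsing : ∀ (i : Fin (r - 1)) (x : ℤ_[p]),
      ((0, Pi.single i x) : ℤ × (Fin (r - 1) → ℤ_[p])) ∈ H := by
    intro i x
    set m : ℤ_[p] := (Nat.card G : ℤ_[p]) with hmdef
    set v := m.valuation
    have hspan := PadicInt.appr_spec v x
    obtain ⟨y, hy⟩ := Ideal.mem_span_singleton'.1 hspan
    have hu : m = (PadicInt.unitCoeff hm : ℤ_[p]) * (p : ℤ_[p]) ^ v :=
      PadicInt.unitCoeff_spec hm
    set u := PadicInt.unitCoeff hm
    have hx : x = (x.appr v : ℤ_[p]) + m * ((u⁻¹ : ℤ_[p]ˣ) * y) := by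
      have h3 : m * (((u⁻¹ : ℤ_[p]ˣ) : ℤ_[p]) * y) = y * (p : ℤ_[p]) ^ v := by
        rw [hu]
        linear_combination (y * (p : ℤ_[p]) ^ v) * (Units.mul_inv u)
      rw [h3, hy]; ring
    have key : ((0, Pi.single i x) : ℤ × (Fin (r - 1) → ℤ_[p])) =
        x.appr v • ((0, Pi.single i 1) : ℤ × (Fin (r - 1) → ℤ_[p])) +
        Nat.card G • ((0, Pi.single i ((u⁻¹ : ℤ_[p]ˣ) * y)) : ℤ × (Fin (r - 1) → ℤ_[p])) := by
      ext j
      · simp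
      · by_cases hj : j = i
        · subst hj
          simpa [hmdef] using hx
        · simp [Pi.single_eq_of_ne hj]
    rw [key]
    exact H.add_mem (H.nsmul_mem ((hH _).2 (h2 i)) _) (hkill _)
  ext a
  obtain ⟨k, w⟩ := a
  have : ((k, w) : ℤ × (Fin (r - 1) → ℤ_[p])) =
      k • (1, 0) + ∑ i, (0, Pi.single i (w i)) := by
    ext j
    · simp [Prod.fst_sum]
    · simp [Prod.snd_sum, Finset.sum_apply, Pi.single_apply]
  have hmem : ((k, w) : ℤ × (Fin (r - 1) → ℤ_[p])) ∈ H := by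
    rw [this]
    exact H.add_mem (H.zsmul_mem ((hH _).2 h1) _) (H.sum_mem fun i _ => hsing i _)
  exact (hH _).1 hmem

/-- The `r`-th `p`-primary equivariant reduced Euler characteristic of the `GL_n(F)`-poset of
nonzero proper subspaces of `F ^ n`, for a finite field `F` and `r ≥ 1`, `n ≥ 1`. -/
def primaryEulerChar (p : ℕ) [Fact p.Prime] (r n : ℕ) (F : Type*) [Field F] : ℚ :=
  (1 / (Nat.card (GL (Fin n) F) : ℚ)) *
    ∑ᶠ X : PrimaryHom p r (GL (Fin n) F),
      (reducedEulerChar (fixedProperSubspaces F n (Set.range X)) : ℚ)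

/-- The `r`-th `p`-primary generating function `1 + ∑_{n ≥ 1} χ̃ᵖ_r(n, |F|) xⁿ`. -/
def primaryGenFun (p : ℕ) [Fact p.Prime] (r : ℕ) (F : Type*) [Field F] : PowerSeries ℚ :=
  PowerSeries.mk fun n => if n = 0 then 1 else primaryEulerChar p r n F

/-- The `p`-part `p ^ ν_p(n)` of a positive natural number `n`. -/
def pPart (p n : ℕ) : ℕ := p ^ padicValNat p n

/-- The power series `exp f`, for `f` with vanishing constant term. -/
def seriesExp (f : PowerSeries ℚ) : PowerSeries ℚ := (PowerSeries.exp ℚ).subst f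

/-- The power `f ^ a = ∑_k (a choose k) (f - 1) ^ k` with a rational exponent `a`, for a power
series `f` with constant term `1`. -/
def seriesPow (f : PowerSeries ℚ) (a : ℚ) : PowerSeries ℚ :=
  (PowerSeries.binomialSeries ℚ a).subst (f - 1)

theorem seriesPow_hasSubst {f : PowerSeries ℚ} (hf : PowerSeries.constantCoeff f = 1) :
    PowerSeries.HasSubst (f - 1) :=
  PowerSeries.HasSubst.of_constantCoeff_zero' (by simp [hf])

theorem seriesPow_natCast {f : PowerSeries ℚ} (hf : PowerSeries.constantCoeff f = 1) (k : ℕ) :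
    seriesPow f (k : ℚ) = f ^ k := by
  have h := seriesPow_hasSubst hf
  have h1 : (PowerSeries.subst (f - 1) (1 + PowerSeries.X : PowerSeries ℚ)) = f := by
    rw [PowerSeries.subst_add h, PowerSeries.subst_X h, ← PowerSeries.coe_substAlgHom h, map_one]
    ring
  rw [seriesPow, PowerSeries.binomialSeries_nat, PowerSeries.subst_pow h, h1]

theorem seriesPow_add {f : PowerSeries ℚ} (hf : PowerSeries.constantCoeff f = 1) (a b : ℚ) :
    seriesPow f (a + b) = seriesPow f a * seriesPow f b := by
  rw [seriesPow, PowerSeries.binomialSeries_add, PowerSeries.subst_mul (seriesPow_hasSubst hf)]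
  rfl

/-- The infinite product `∏_{n ≥ 0} f n` of formal power series converges (unconditionally, in
the `x`-adic topology) to `g`: every coefficient of the finite partial products is eventually
equal to the one of `g`. -/
def HasFormalProd (f : ℕ → PowerSeries ℚ) (g : PowerSeries ℚ) : Prop :=
  ∀ m : ℕ, ∀ᶠ s : Finset ℕ in Filter.atTop,
    PowerSeries.coeff m (∏ n ∈ s, f n) = PowerSeries.coeff m g

end

/-! ### Reduced Euler characteristics of finite posets -/

section EulerChar

/-! Let `A = ℤ × ℤ_p ^ (r - 1)`, let `F` be a finite field with `Q` elements and characteristic `l ≠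
p`, and let `G(x)` be the series with coefficients `|Hom(A, GL_n(F))| / |GL_n(F)|`. The generating
function of the Euler characteristics turns out to be `1 / G`, and `x G' = T G` with `T = ∑ ((Q^n -
1)_p)^(r-1) x^n`. Every claim is then read off from `x B' = -T B`, which has only one solution with
constant term `1`.

Inversion. For a nonzero representation `X`, sorting chains of invariant subspaces by their largest
member gives `∑ χ̃(X|W) = 0` over all invariant `W`, where the zero space counts `1`
(`sum_equivariantChar_restrict`). Sum this over all `X` and exchange the sums. The `X` that preserve
`W` are the homomorphisms to a parabolic subgroup. Its unipotent radical `U` is an `l`-group, so its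
order is prime to `p`, and every homomorphism from `A` to the Levi quotient has exactly `|U|` lifts
(`card_primaryHom_lifts`). Weighted by group orders, the sum becomes the convolution identity
`sum_charWeight_mul_homWeight`.

Counting. By Burnside, `|Hom(A, GL_n(F))| / |GL_n(F)|` is the number of isomorphism classes of
`n`-dimensional representations of `H = (ℤ/p^N)^(r-1)`, for `N` large in terms of `n`. By Maschke
these are multiplicity functions on the simple quotients of `F[H]`, of degrees `d_I`, so the counts
have generating function `∏ 1 / (1 - x^(d_I))`. The `k`-th coefficient of its logarithmic
derivative, the sum of the `d_I` dividing `k`, is the number of `F`-algebra maps from `F[H]` to the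
extension `E` of degree `k`. That number is `|Hom(H, Eˣ)| = ((Q^k - 1)_p)^(r-1)`.

Specialization. A primitive root modulo `p^2` gives `v_p(q - 1) = 1`, and lifting the exponent gives
`v_p(q^(p^e n) - 1) = 1 + e + v_p(n)`. Changing `e` thus scales `T` by a constant, which yields the
power relation. Sorting the `n` by `v_p(n)` yields the product. Its factors are congruent to `1`
modulo `p`, which yields the divisibility. -/

theorem reducedEulerChar_congr {P Q : Type*} [PartialOrder P] [PartialOrder Q] (e : P ≃o Q) :
    reducedEulerChar P = reducedEulerChar Q := by
  unfold reducedEulerChar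
  refine finsum_eq_of_bijective
    (fun c => ⟨c.1.map e.toEquiv.toEmbedding, by
      rw [Finset.coe_map]
      exact c.2.image_of_map_rel _ _ e fun _ _ h => e.monotone h⟩) ⟨?_, ?_⟩ ?_
  · intro c d h
    simpa [Subtype.ext_iff] using h
  · intro c
    refine ⟨⟨c.1.map e.symm.toEquiv.toEmbedding, by
      rw [Finset.coe_map]
      exact c.2.image_of_map_rel _ _ e.symm fun _ _ h => e.symm.monotone h⟩, ?_⟩
    ext x
    simp
  · intro c
    simp

theorem IsChain.cons_map_subtype_lt {P : Type*} [PartialOrder P] (w : P)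
    {c : Finset {x : P // x < w}}
    (hc : IsChain (· ≤ ·) (c : Set {x : P // x < w})) :
    IsChain (· ≤ ·) (Finset.cons w (c.map (Function.Embedding.subtype _))
      (by simp) : Set P) := by
  rw [Finset.coe_cons, Finset.coe_map]
  refine (hc.image_of_map_rel _ (· ≤ ·) (Function.Embedding.subtype _) fun _ _ h => h).insert ?_
  rintro _ ⟨x, -, rfl⟩ -
  exact Or.inr x.2.le

/-- Sorting the nonempty chains of a finite poset by their largest elements. -/
theorem reducedEulerChar_eq_sum (P : Type*) [PartialOrder P] [Fintype P] :
    reducedEulerChar P = -1 - ∑ w : P, reducedEulerChar {x : P // x < w} := by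
  classical
  -- `none` stands for the empty chain, and `⟨w, c⟩` for the chain with maximum `w` and remainder
  -- `c`. Adjoining `w` flips the sign.
  let Φ : Option (Σ w : P, {c : Finset {x : P // x < w} //
      IsChain (· ≤ ·) (c : Set {x : P // x < w})}) →
      {c : Finset P // IsChain (· ≤ ·) (c : Set P)} := fun o =>
    o.elim ⟨∅, by simp⟩ fun c => ⟨_, c.2.2.cons_map_subtype_lt c.1⟩
  have hmax : ∀ (w v : P) (c : Finset {x : P // x < w}) (d : Finset {x : P // x < v}),
      Finset.cons w (c.map (Function.Embedding.subtype _)) (by simp) =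
        Finset.cons v (d.map (Function.Embedding.subtype _)) (by simp) → w ≤ v := by
    intro w v c d h
    have hw : w ∈ Finset.cons v (d.map (Function.Embedding.subtype _)) (by simp) := by
      rw [← h]; simp
    simp only [Finset.mem_cons, Finset.mem_map, Function.Embedding.subtype_apply] at hw
    rcases hw with rfl | ⟨x, -, rfl⟩
    · exact le_rfl
    · exact x.2.le
  have hΦ : Function.Bijective Φ := by
    constructor
    · rintro (_ | ⟨w, c, hc⟩) (_ | ⟨v, d, hd⟩) h
      · rfl
      · exact absurd (congrArg Subtype.val h).symm (by simp [Φ])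
      · exact absurd (congrArg Subtype.val h) (by simp [Φ])
      · have h' := congrArg Subtype.val h
        simp only [Φ, Option.elim_some] at h'
        obtain rfl : w = v := le_antisymm (hmax _ _ _ _ h') (hmax _ _ _ _ h'.symm)
        have : c.map (Function.Embedding.subtype _) = d.map (Function.Embedding.subtype _) := by
          have h2 := congrArg (fun s => s.erase w) h'
          simpa using h2
        obtain rfl := Finset.map_injective _ this
        rfl
    · rintro ⟨c, hc⟩
      rcases c.eq_empty_or_nonempty with rfl | hne
      · exact ⟨none, rfl⟩
      · obtain ⟨w, hw⟩ := c.exists_maximal hne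
        have hlt : ∀ x ∈ c, x ≠ w → x < w := by
          intro x hx hxw
          rcases hc hx hw.1 hxw with h | h
          · exact lt_of_le_of_ne h hxw
          · exact absurd (le_antisymm (hw.2 hx h) h) hxw
        refine ⟨some ⟨w, c.subtype (· < w), ?_⟩, ?_⟩
        · intro a ha b hb hab
          simp only [Finset.mem_coe, Finset.mem_subtype] at ha hb
          exact hc ha hb (fun h => hab (Subtype.ext h))
        · apply Subtype.ext
          ext x
          simp only [Φ, Option.elim_some, Finset.mem_cons, Finset.mem_map, Finset.mem_subtype,
            Function.Embedding.subtype_apply, Subtype.exists, exists_and_left, exists_prop,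
            exists_eq_right_right]
          constructor
          · rintro (rfl | h)
            · exact hw.1
            · exact h.1
          · intro hx
            by_cases h : x = w
            · exact Or.inl h
            · exact Or.inr ⟨hx, hlt x hx h⟩
  unfold reducedEulerChar
  have key : ∑ᶠ c : {c : Finset P // IsChain (· ≤ ·) (c : Set P)}, (-1 : ℤ) ^ (c.1.card + 1) =
      ∑ᶠ o, (-1 : ℤ) ^ ((Φ o).1.card + 1) :=
    (finsum_eq_of_bijective Φ hΦ fun _ => rfl).symm
  rw [key, finsum_eq_sum_of_fintype, Fintype.sum_option, Fintype.sum_sigma]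
  simp only [Φ, Option.elim_some, Option.elim_none, Finset.card_cons, Finset.card_map,
    Finset.card_empty]
  simp only [finsum_eq_sum_of_fintype]
  rw [sub_eq_add_neg, ← Finset.sum_neg_distrib]
  congr 1
  refine Finset.sum_congr rfl fun w _ => ?_
  rw [← Finset.sum_neg_distrib]
  refine Finset.sum_congr rfl fun c _ => ?_
  ring

end EulerChar

/-! ### Lifting commuting tuples through a kernel of order prime to `p` -/

section Lifts

theorem exists_lift_pow_eq_one {p : ℕ} {P Q : Type*} [Group P] [Group Q] {π : P →* Q}
    (hU : p.Coprime (Nat.card π.ker)) {C : Subgroup P} {h : Q} (hC : h ∈ C.map π) {k : ℕ} (hk : h ^ p ^ k = 1) :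
    ∃ x ∈ C, π x = h ∧ x ^ p ^ k = 1 := by
  obtain ⟨x, hx, rfl⟩ := hC
  -- With `N ≡ 1` modulo `p ^ k` and `N ≡ 0` modulo the order of the kernel, the power `x ^ N` still
  -- lifts `π x`, while its part in the kernel is killed.
  obtain ⟨N, hN1, hN2⟩ := Nat.chineseRemainder (hU.pow_left k) 1 0
  refine ⟨x ^ N, C.pow_mem hx N, ?_, ?_⟩
  · rw [map_pow]
    have := pow_eq_pow_iff_modEq (x := π x) (n := N) (m := 1)
    rw [pow_one] at this
    exact this.2 (hN1.of_dvd (orderOf_dvd_of_pow_eq_one hk))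
  · rw [← pow_mul, mul_comm, pow_mul]
    obtain ⟨c, rfl⟩ := (Nat.modEq_zero_iff_dvd.1 hN2)
    have hmem : x ^ p ^ k ∈ π.ker := by rw [MonoidHom.mem_ker, map_pow, hk]
    have := pow_card_eq_one' (x := (⟨_, hmem⟩ : π.ker))
    rw [Subtype.ext_iff] at this
    rw [pow_mul]
    rw [show (x ^ p ^ k) ^ Nat.card π.ker = 1 from this, one_pow]

variable {p : ℕ} [hp : Fact p.Prime] {P Q : Type*} [Group P] [Group Q] [Finite P]

/-- The permutation `u ↦ y u x⁻¹` of `C ⊓ π.ker` has `p`-power order and acts on a set of size prime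
to `p`, so it has a fixed point. A fixed point is exactly an element conjugating `x` to `y`. -/
theorem exists_conj_eq_of_map_eq {π : P →* Q} (hU : p.Coprime (Nat.card π.ker)) {C : Subgroup P}
    {x y : P} (hx : x ∈ C) (hy : y ∈ C) {k l : ℕ} (hxk : x ^ p ^ k = 1) (hyl : y ^ p ^ l = 1)
    (hxy : π x = π y) : ∃ u ∈ C ⊓ π.ker, u * x * u⁻¹ = y := by
  classical
  have hmem : ∀ u, u ∈ C ⊓ π.ker → y * u * x⁻¹ ∈ C ⊓ π.ker := by
    rintro u ⟨h1, h2⟩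
    refine ⟨C.mul_mem (C.mul_mem hy h1) (C.inv_mem hx), ?_⟩
    change π (y * u * x⁻¹) = 1
    rw [map_mul, map_mul, MonoidHom.mem_ker.1 h2, map_inv, hxy]
    group
  have hmem' : ∀ u, u ∈ C ⊓ π.ker → y⁻¹ * u * x ∈ C ⊓ π.ker := by
    rintro u ⟨h1, h2⟩
    refine ⟨C.mul_mem (C.mul_mem (C.inv_mem hy) h1) hx, ?_⟩
    change π (y⁻¹ * u * x) = 1
    rw [map_mul, map_mul, MonoidHom.mem_ker.1 h2, map_inv, hxy]
    group
  let σ : Equiv.Perm ↥(C ⊓ π.ker) :=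
    { toFun := fun u => ⟨y * u * x⁻¹, hmem u u.2⟩
      invFun := fun u => ⟨y⁻¹ * u * x, hmem' u u.2⟩
      left_inv := fun u => by ext; simp; group
      right_inv := fun u => by ext; simp; group }
  have hσ : ∀ (n : ℕ) u, (((σ ^ n) u : ↥(C ⊓ π.ker)) : P) = y ^ n * u * (x ^ n)⁻¹ := by
    intro n
    induction n with
    | zero => simp
    | succ n ih =>
      intro u
      rw [pow_succ', Equiv.Perm.mul_apply]
      change y * ((σ ^ n) u : P) * x⁻¹ = _
      rw [ih]
      rw [pow_succ', pow_succ]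
      group
  have h1 : σ ^ p ^ (k + l) = 1 := by
    ext u
    rw [hσ, pow_add, pow_mul x, hxk, one_pow, mul_comm, pow_mul y, hyl, one_pow]
    simp
  let _ := Fintype.ofFinite ↥(C ⊓ π.ker)
  have h2 : ¬ p ∣ Fintype.card ↥(C ⊓ π.ker) := by
    rw [← Nat.card_eq_fintype_card]
    intro h
    have h3 := h.trans (Subgroup.card_dvd_of_le (inf_le_right : C ⊓ π.ker ≤ π.ker))
    exact hp.out.one_lt.ne' (Nat.dvd_one.1 (hU.gcd_eq_one ▸ Nat.dvd_gcd dvd_rfl h3))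
  obtain ⟨u, hu⟩ := Equiv.Perm.exists_fixed_point_of_prime h2 h1
  refine ⟨u, u.2, ?_⟩
  have h3 : y * u * x⁻¹ = (u : P) := congrArg Subtype.val hu
  rw [mul_inv_eq_iff_eq_mul] at h3 ⊢
  exact h3.symm

/-- The lifts to `C` of an element, of `p`-power order. -/
def primaryLifts (p : ℕ) (π : P →* Q) (C : Subgroup P) (h : Q) : Set P :=
  {x | x ∈ C ∧ (∃ k, x ^ p ^ k = 1) ∧ π x = h}

/-- Orbit-stabilizer: `C ⊓ π.ker` acts by conjugation on the lifts, transitively by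
`exists_conj_eq_of_map_eq`. -/
theorem card_primaryLifts_mul {π : P →* Q} (hU : p.Coprime (Nat.card π.ker)) {C : Subgroup P}
    {h : Q} {x : P} (hx : x ∈ primaryLifts p π C h) :
    Nat.card (primaryLifts p π C h) *
      Nat.card ↥(C ⊓ Subgroup.centralizer {x} ⊓ π.ker) = Nat.card ↥(C ⊓ π.ker) := by
  let _ : MulAction ↥(C ⊓ π.ker) P :=
    MulAction.compHom P ((MulAut.conj (G := P)).comp (C ⊓ π.ker).subtype)
  have hsmul : ∀ (u : ↥(C ⊓ π.ker)) (a : P), u • a = (u : P) * a * (u : P)⁻¹ := fun u a => rfl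
  have horb : MulAction.orbit ↥(C ⊓ π.ker) x = primaryLifts p π C h := by
    obtain ⟨h1, ⟨k, hk⟩, h2⟩ := hx
    ext y
    constructor
    · rintro ⟨u, rfl⟩
      have hu := u.2
      simp only [hsmul]
      refine ⟨C.mul_mem (C.mul_mem hu.1 h1) (C.inv_mem hu.1), ⟨k, ?_⟩, ?_⟩
      · rw [conj_pow, hk]; simp
      · rw [map_mul, map_mul, map_inv, MonoidHom.mem_ker.1 hu.2, h2]; simp
    · rintro ⟨h3, ⟨l, hl⟩, h4⟩
      obtain ⟨u, hu, hux⟩ := exists_conj_eq_of_map_eq hU h1 h3 hk hl (h2.trans h4.symm)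
      exact ⟨⟨u, hu⟩, hux⟩
  have hstab : Nat.card (MulAction.stabilizer ↥(C ⊓ π.ker) x) =
      Nat.card ↥(C ⊓ Subgroup.centralizer {x} ⊓ π.ker) := by
    have hm : ∀ u : ↥(C ⊓ π.ker), u ∈ MulAction.stabilizer ↥(C ⊓ π.ker) x ↔
        (u : P) ∈ Subgroup.centralizer {x} := by
      intro u
      rw [MulAction.mem_stabilizer_iff, hsmul, Subgroup.mem_centralizer_singleton_iff,
        mul_inv_eq_iff_eq_mul]
    refine Nat.card_congr
      ⟨fun u => ⟨u.1, ⟨u.1.2.1, (hm _).1 u.2⟩, u.1.2.2⟩,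
        fun u => ⟨⟨u.1, u.2.1.1, u.2.2⟩, (hm _).2 u.2.1.2⟩, fun _ => rfl, fun _ => rfl⟩
  rw [← hstab, ← horb, ← Nat.card_prod]
  exact Nat.card_congr (MulAction.orbitProdStabilizerEquivGroup _ x)

/-- The tuples `(z, h_1, …, h_s)` of commuting elements where all `h_i` have `p`-power order. -/
def primaryTuples (p s : ℕ) (G : Type*) [Group G] : Set (G × (Fin s → G)) :=
  {x | (∀ i, ∃ k, x.2 i ^ p ^ k = 1) ∧ (∀ i, Commute x.1 (x.2 i)) ∧
    ∀ i j, Commute (x.2 i) (x.2 j)}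

/-- The lifts in `C` of a tuple of commuting elements. -/
def tupleLifts (p : ℕ) {s : ℕ} (π : P →* Q) (C : Subgroup P) (y : Q × (Fin s → Q)) :
    Set (P × (Fin s → P)) :=
  {x | x ∈ primaryTuples p s P ∧ (x.1 ∈ C ∧ ∀ i, x.2 i ∈ C) ∧
    π x.1 = y.1 ∧ ∀ i, π (x.2 i) = y.2 i}

/-- Splitting off the first `p`-element of a tuple. -/
def tupleLiftsSuccEquiv {s : ℕ} (π : P →* Q) (C : Subgroup P) (y : Q × (Fin (s + 1) → Q)) :
    tupleLifts p π C y ≃ Σ a : primaryLifts p π C (y.2 0),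
      tupleLifts p π (C ⊓ Subgroup.centralizer {a.1}) (y.1, Fin.tail y.2) where
  toFun x := ⟨⟨x.1.2 0, x.2.2.1.2 0, x.2.1.1 0, x.2.2.2.2 0⟩, ⟨(x.1.1, Fin.tail x.1.2),
    ⟨fun i => x.2.1.1 i.succ, fun i => x.2.1.2.1 i.succ, fun i j => x.2.1.2.2 i.succ j.succ⟩,
    ⟨⟨x.2.2.1.1, Subgroup.mem_centralizer_singleton_iff.2 (x.2.1.2.1 0)⟩,
      fun i => ⟨x.2.2.1.2 i.succ, Subgroup.mem_centralizer_singleton_iff.2 (x.2.1.2.2 i.succ 0)⟩⟩,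
    x.2.2.2.1, fun i => x.2.2.2.2 i.succ⟩⟩
  invFun x := ⟨(x.2.1.1, Fin.cons x.1.1 x.2.1.2), by
    obtain ⟨⟨a, ha1, ha2, ha3⟩, ⟨z, h⟩, ⟨h1, h2, h3⟩, ⟨h4, h5⟩, h6, h7⟩ := x
    have hz : Commute z a := Subgroup.mem_centralizer_singleton_iff.1 h4.2
    have hh : ∀ i, Commute (h i) a := fun i => Subgroup.mem_centralizer_singleton_iff.1 (h5 i).2
    refine ⟨⟨?_, ?_, ?_⟩, ⟨h4.1, ?_⟩, h6, ?_⟩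
    · exact Fin.cases ha2 h1
    · exact Fin.cases hz h2
    · refine Fin.cases (Fin.cases (Commute.refl _) fun i => (hh i).symm) fun i => ?_
      exact Fin.cases (hh i) (h3 i)
    · exact Fin.cases ha1 fun i => (h5 i).1
    · exact Fin.cases ha3 h7⟩
  left_inv x := by
    obtain ⟨⟨z, h⟩, hx⟩ := x
    simp [Fin.cons_self_tail]
  right_inv x := by
    obtain ⟨⟨a, ha⟩, ⟨⟨z, h⟩, hx⟩⟩ := x
    rfl

/-- If the kernel of `π` has order prime to `p`, then all tuples of commuting elements have the
same number of lifts. -/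
theorem card_tupleLifts {π : P →* Q} (hU : p.Coprime (Nat.card π.ker)) {s : ℕ} :
    ∀ (C : Subgroup P) (y : Q × (Fin s → Q)), y ∈ primaryTuples p s Q → y.1 ∈ C.map π →
      (∀ i, y.2 i ∈ C.map π) → Nat.card (tupleLifts p π C y) = Nat.card ↥(C ⊓ π.ker) := by
  induction s with
  | zero =>
    intro C y _ hy _
    -- The first entry has no order condition, so its lifts form a full coset of `C ⊓ π.ker`.
    obtain ⟨z, hz, hzy⟩ := hy
    refine Nat.card_congr ⟨fun x => ⟨z⁻¹ * x.1.1, C.mul_mem (C.inv_mem hz) x.2.2.1.1, ?_⟩,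
      fun u => ⟨(z * u, Fin.elim0), ⟨fun i => i.elim0, fun i => i.elim0, fun i => i.elim0⟩,
        ⟨C.mul_mem hz u.2.1, fun i => i.elim0⟩, ?_, fun i => i.elim0⟩, ?_, ?_⟩
    · change π (z⁻¹ * x.1.1) = 1
      rw [map_mul, map_inv, hzy, x.2.2.2.1, inv_mul_cancel]
    · change π (z * u) = y.1
      rw [map_mul, hzy, MonoidHom.mem_ker.1 u.2.2, mul_one]
    · rintro ⟨⟨x, h⟩, hx⟩
      simp only [mul_inv_cancel_left, Subtype.mk.injEq, Prod.mk.injEq, true_and]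
      exact Subsingleton.elim _ _
    · rintro ⟨u, hu⟩
      simp
  | succ s ih =>
    intro C y hy hy1 hy2
    let _ := Fintype.ofFinite (primaryLifts p π C (y.2 0))
    rw [Nat.card_congr (tupleLiftsSuccEquiv π C y), Nat.card_sigma]
    -- The induction continues inside the centralizer of the chosen lift `a`, so the other entries
    -- must lift there. If `c` lifts `w`, then `a` and `c a c⁻¹` lift the same element. They are
    -- conjugate by some `u` in the kernel, and `u⁻¹ c` is a lift of `w` centralizing `a`.
    have hcent : ∀ (a : primaryLifts p π C (y.2 0)) (w : Q), w ∈ C.map π → Commute w (y.2 0) →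
        w ∈ (C ⊓ Subgroup.centralizer {a.1}).map π := by
      rintro ⟨a, ha1, ⟨k, hk⟩, ha2⟩ _ ⟨c, hc, rfl⟩ hw
      obtain ⟨u, hu, hua⟩ := exists_conj_eq_of_map_eq hU ha1
        (C.mul_mem (C.mul_mem hc ha1) (C.inv_mem hc)) hk
        (l := k) (by rw [conj_pow, hk]; simp) (y := c * a * c⁻¹) (by
          rw [map_mul, map_mul, map_inv, ha2, hw.eq, mul_inv_cancel_right])
      refine ⟨u⁻¹ * c, ⟨C.mul_mem (C.inv_mem hu.1) hc, ?_⟩, ?_⟩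
      · refine Subgroup.mem_centralizer_singleton_iff.2 ?_
        have h1 : u * a = c * a * c⁻¹ * u := by rw [← hua]; group
        calc u⁻¹ * c * a = u⁻¹ * (c * a * c⁻¹ * u) * u⁻¹ * c := by group
          _ = u⁻¹ * (u * a) * u⁻¹ * c := by rw [h1]
          _ = a * (u⁻¹ * c) := by group
      · rw [map_mul, map_inv, MonoidHom.mem_ker.1 hu.2]; simp
    have hterm : ∀ a : primaryLifts p π C (y.2 0),
        Nat.card (tupleLifts p π (C ⊓ Subgroup.centralizer {a.1}) (y.1, Fin.tail y.2)) =
          Nat.card ↥(C ⊓ Subgroup.centralizer {a.1} ⊓ π.ker) := fun a =>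
      ih _ _ ⟨fun i => hy.1 i.succ, fun i => hy.2.1 i.succ, fun i j => hy.2.2 i.succ j.succ⟩
        (hcent a _ hy1 (hy.2.1 0)) fun i => hcent a _ (hy2 i.succ) (hy.2.2 i.succ 0)
    obtain ⟨k, hk⟩ := hy.1 0
    obtain ⟨x, hx1, hx2, hx3⟩ := exists_lift_pow_eq_one hU (hy2 0) hk
    have hx : x ∈ primaryLifts p π C (y.2 0) := ⟨hx1, ⟨k, hx3⟩, hx2⟩
    have hconst : ∀ a ∈ (Finset.univ : Finset (primaryLifts p π C (y.2 0))),
        Nat.card (tupleLifts p π (C ⊓ Subgroup.centralizer {a.1}) (y.1, Fin.tail y.2)) =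
          Nat.card ↥(C ⊓ Subgroup.centralizer {x} ⊓ π.ker) := by
      intro a _
      rw [hterm]
      have h1 := card_primaryLifts_mul hU a.2
      rw [← card_primaryLifts_mul hU hx] at h1
      have h2 : 0 < Nat.card (primaryLifts p π C (y.2 0)) :=
        Nat.card_pos_iff.2 ⟨⟨⟨x, hx⟩⟩, inferInstance⟩
      exact Nat.eq_of_mul_eq_mul_left h2 h1
    rw [Finset.sum_congr rfl hconst, Finset.sum_const, smul_eq_mul, Finset.card_univ,
      ← Nat.card_eq_fintype_card, card_primaryLifts_mul hU hx]

end Lifts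

/-! ### Homomorphisms from `ℤ × ℤ_p ^ (r - 1)` to finite groups -/

noncomputable section PrimaryHomTuples

variable (p : ℕ) {G : Type*} [Group G]

/-- The homomorphism `ℤ × (ℤ/p^N)^s → G` with prescribed commuting values on the generators. -/
def homOfTuple {s N : ℕ} (x : G × (Fin s → G)) (hx : x ∈ primaryTuples p s G)
    (hN : ∀ i, x.2 i ^ p ^ N = 1) : ℤ × (Fin s → ZMod (p ^ N)) →+ Additive G :=
  let φ : Fin s → ZMod (p ^ N) →+ Additive G := fun i =>
    ZMod.lift (p ^ N) ⟨zmultiplesHom (Additive G) (Additive.ofMul (x.2 i)), by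
      rw [zmultiplesHom_apply, natCast_zsmul, ← ofMul_pow, hN, ofMul_one]⟩
  have hφ : ∀ i (a : ZMod (p ^ N)), ∃ k : ℤ, φ i a = Additive.ofMul (x.2 i ^ k) := fun i a => by
    obtain ⟨k, rfl⟩ := ZMod.intCast_surjective a
    exact ⟨k, by simp only [φ, ZMod.lift_coe, zmultiplesHom_apply, ofMul_zpow]⟩
  have hcomm : Pairwise fun i j => ∀ a b, AddCommute (φ i a) (φ j b) := fun i j _ a b => by
    obtain ⟨k, hk⟩ := hφ i a
    obtain ⟨l, hl⟩ := hφ j b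
    rw [hk, hl]
    exact congrArg Additive.ofMul ((hx.2.2 i j).zpow_zpow k l).eq
  AddMonoidHom.noncommCoprod (zmultiplesHom (Additive G) (Additive.ofMul x.1))
    (AddMonoidHom.noncommPiCoprod φ hcomm) fun m a => by
      have : ∀ w : Additive G, w ∈ AddMonoidHom.mrange (AddMonoidHom.noncommPiCoprod φ hcomm) →
          AddCommute (zmultiplesHom (Additive G) (Additive.ofMul x.1) m) w := by
        intro w hw
        rw [AddMonoidHom.noncommPiCoprod_mrange] at hw
        -- A centralizer is a submonoid, so commutation need only be checked on the range of each
        -- cyclic factor.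
        have hle : (⨆ i, AddMonoidHom.mrange (φ i)) ≤ AddSubmonoid.centralizer
            {zmultiplesHom (Additive G) (Additive.ofMul x.1) m} := by
          refine iSup_le fun i => ?_
          rintro _ ⟨a, rfl⟩
          obtain ⟨k, hk⟩ := hφ i a
          rw [hk, AddSubmonoid.mem_centralizer_iff]
          rintro _ rfl
          rw [zmultiplesHom_apply]
          exact congrArg Additive.ofMul ((hx.2.1 i).zpow_zpow m k).eq
        exact (AddSubmonoid.mem_centralizer_iff.1 (hle hw)) _ rfl
      exact this _ ⟨a, rfl⟩

theorem homOfTuple_one_zero {s N : ℕ} (x : G × (Fin s → G)) (hx : x ∈ primaryTuples p s G)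
    (hN : ∀ i, x.2 i ^ p ^ N = 1) : homOfTuple p x hx hN (1, 0) = Additive.ofMul x.1 := by
  simp [homOfTuple]

theorem homOfTuple_zero_single {s N : ℕ} (x : G × (Fin s → G)) (hx : x ∈ primaryTuples p s G)
    (hN : ∀ i, x.2 i ^ p ^ N = 1) (i : Fin s) :
    homOfTuple p x hx hN (0, Pi.single i 1) = Additive.ofMul (x.2 i) := by
  simp only [homOfTuple, AddMonoidHom.noncommCoprod_apply, map_zero, zero_add]
  refine (AddMonoidHom.noncommPiCoprod_single _ i _).trans ?_
  rw [← Int.cast_one, ZMod.lift_coe]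
  simp

variable {p} [hp : Fact p.Prime]

/-- The values of a homomorphism on the generators. -/
def PrimaryHom.tuple {r : ℕ} (f : PrimaryHom p r G) : G × (Fin (r - 1) → G) :=
  (f (Multiplicative.ofAdd (1, 0)), fun i => f (Multiplicative.ofAdd (0, Pi.single i 1)))

/-- A homomorphism to a finite group kills all multiples of `|G|`, and every `p`-adic integer is a
natural number plus a multiple of `|G|`. The generators therefore determine it without any
continuity assumption. -/
theorem PrimaryHom.tuple_injective [Finite G] {r : ℕ} :
    Function.Injective (PrimaryHom.tuple : PrimaryHom p r G → _) := by
  intro f g hfg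
  have h1 : f (Multiplicative.ofAdd (1, 0)) = g (Multiplicative.ofAdd (1, 0)) :=
    congrArg Prod.fst hfg
  have h2 : ∀ i, f (Multiplicative.ofAdd (0, Pi.single i 1)) =
      g (Multiplicative.ofAdd (0, Pi.single i 1)) := fun i => congrFun (congrArg Prod.snd hfg) i
  let H : AddSubgroup (ℤ × (Fin (r - 1) → ℤ_[p])) := Subgroup.toAddSubgroup' (f.eqLocus g)
  have hH : ∀ a, a ∈ H ↔ f (Multiplicative.ofAdd a) = g (Multiplicative.ofAdd a) :=
    fun a => Iff.rfl
  have hkill : ∀ a, Nat.card G • a ∈ H := by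
    intro a
    rw [hH, ofAdd_nsmul, map_pow, map_pow, pow_card_eq_one', pow_card_eq_one']
  have hm : (Nat.card G : ℤ_[p]) ≠ 0 := by exact_mod_cast Nat.card_pos.ne'
  have hsing : ∀ (i : Fin (r - 1)) (x : ℤ_[p]),
      ((0, Pi.single i x) : ℤ × (Fin (r - 1) → ℤ_[p])) ∈ H := by
    intro i x
    set m : ℤ_[p] := (Nat.card G : ℤ_[p]) with hmdef
    set v := m.valuation
    have hspan := PadicInt.appr_spec v x
    obtain ⟨y, hy⟩ := Ideal.mem_span_singleton'.1 hspan
    have hu : m = (PadicInt.unitCoeff hm : ℤ_[p]) * (p : ℤ_[p]) ^ v :=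
      PadicInt.unitCoeff_spec hm
    set u := PadicInt.unitCoeff hm
    have hx : x = (x.appr v : ℤ_[p]) + m * ((u⁻¹ : ℤ_[p]ˣ) * y) := by
      have h3 : m * (((u⁻¹ : ℤ_[p]ˣ) : ℤ_[p]) * y) = y * (p : ℤ_[p]) ^ v := by
        rw [hu]
        linear_combination (y * (p : ℤ_[p]) ^ v) * (Units.mul_inv u)
      rw [h3, hy]; ring
    have key : ((0, Pi.single i x) : ℤ × (Fin (r - 1) → ℤ_[p])) =
        x.appr v • ((0, Pi.single i 1) : ℤ × (Fin (r - 1) → ℤ_[p])) +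
        Nat.card G • ((0, Pi.single i ((u⁻¹ : ℤ_[p]ˣ) * y)) : ℤ × (Fin (r - 1) → ℤ_[p])) := by
      ext j
      · simp
      · by_cases hj : j = i
        · subst hj
          simpa [hmdef] using hx
        · simp [Pi.single_eq_of_ne hj]
    rw [key]
    exact H.add_mem (H.nsmul_mem ((hH _).2 (h2 i)) _) (hkill _)
  ext a
  obtain ⟨k, w⟩ := a
  have : ((k, w) : ℤ × (Fin (r - 1) → ℤ_[p])) =
      k • (1, 0) + ∑ i, (0, Pi.single i (w i)) := by
    ext j
    · simp [Prod.fst_sum]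
    · simp [Prod.snd_sum, Finset.sum_apply, Pi.single_apply]
  have hmem : ((k, w) : ℤ × (Fin (r - 1) → ℤ_[p])) ∈ H := by
    rw [this]
    exact H.add_mem (H.zsmul_mem ((hH _).2 h1) _) (H.sum_mem fun i _ => hsing i _)
  exact (hH _).1 hmem

/-- Write `|G| = p ^ v * m` with `m` prime to `p`. Since `m` is a unit of `ℤ_p`, each generator of a
`ℤ_p` factor is `m` times an element, so its value is killed by `p ^ v`. -/
theorem PrimaryHom.tuple_mem [Finite G] {r : ℕ} (f : PrimaryHom p r G) :
    f.tuple ∈ primaryTuples p (r - 1) G := by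
  have hc : ∀ a b, Commute (f a) (f b) := fun a b => by
    rw [Commute, SemiconjBy, ← map_mul, ← map_mul, mul_comm]
  refine ⟨fun i => ?_, fun i => hc _ _, fun i j => hc _ _⟩
  obtain ⟨v, m, hm, hcard⟩ := Nat.exists_eq_pow_mul_and_not_dvd (Nat.card_pos (α := G)).ne' p
    hp.out.ne_one
  have hu : IsUnit (m : ℤ_[p]) := by
    rw [PadicInt.isUnit_iff]
    exact (PadicInt.norm_natCast_eq_one_iff).2 ((Nat.Prime.coprime_iff_not_dvd hp.out).2 hm)
  obtain ⟨y, hy⟩ := hu.exists_right_inv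
  refine ⟨v, ?_⟩
  have h1 : (Multiplicative.ofAdd ((0, Pi.single i 1) : ℤ × (Fin (r - 1) → ℤ_[p]))) =
      Multiplicative.ofAdd (0, Pi.single i y) ^ m := by
    rw [← ofAdd_nsmul]
    congr 1
    ext j
    · simp
    · by_cases hj : j = i
      · subst hj; simp [hy]
      · simp [Pi.single_eq_of_ne hj]
  change f _ ^ p ^ v = 1
  rw [h1, map_pow, ← pow_mul, mul_comm, ← hcard, pow_card_eq_one']

theorem exists_primaryHom_tuple_eq {r : ℕ} (x : G × (Fin (r - 1) → G))
    (hx : x ∈ primaryTuples p (r - 1) G) : ∃ f : PrimaryHom p r G, f.tuple = x := by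
  choose k hk using hx.1
  -- A common exponent for all the `p`-elements, so that the homomorphism can be built through
  -- reduction modulo `p ^ N`.
  let N := ∑ i, k i
  have hN : ∀ i, x.2 i ^ p ^ N = 1 := fun i => by
    obtain ⟨c, hc⟩ := pow_dvd_pow p (Finset.single_le_sum (fun _ _ => Nat.zero_le _)
      (Finset.mem_univ i) : k i ≤ N)
    rw [hc, pow_mul, hk, one_pow]
  let ρ : ℤ × (Fin (r - 1) → ℤ_[p]) →+ ℤ × (Fin (r - 1) → ZMod (p ^ N)) :=
    (AddMonoidHom.id ℤ).prodMap
      ((PadicInt.toZModPow (p := p) N).toAddMonoidHom.compLeft (Fin (r - 1)))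
  refine ⟨AddMonoidHom.toMultiplicativeLeft ((homOfTuple p x hx hN).comp ρ), ?_⟩
  refine Prod.ext ?_ (funext fun i => ?_)
  · have h1 : ρ (1, 0) = (1, 0) := by
      refine Prod.ext rfl ?_
      ext j
      simp [ρ]
    change Additive.toMul (homOfTuple p x hx hN (ρ (1, 0))) = _
    rw [h1, homOfTuple_one_zero, toMul_ofMul]
  · have h1 : ρ (0, Pi.single i 1) = (0, Pi.single i 1) := by
      refine Prod.ext rfl ?_
      ext j
      by_cases hj : j = i
      · subst hj; simp [ρ]
      · simp [ρ, Pi.single_eq_of_ne hj]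
    change Additive.toMul (homOfTuple p x hx hN (ρ (0, Pi.single i 1))) = _
    rw [h1, homOfTuple_zero_single, toMul_ofMul]

/-- Homomorphisms `ℤ × ℤ_p ^ (r - 1) → G` are tuples of commuting elements. -/
def primaryHomEquiv [Finite G] (r : ℕ) : PrimaryHom p r G ≃ primaryTuples p (r - 1) G :=
  Equiv.ofBijective (fun f => ⟨f.tuple, f.tuple_mem⟩)
    ⟨fun _ _ h => PrimaryHom.tuple_injective (congrArg Subtype.val h), fun x => by
      obtain ⟨f, hf⟩ := exists_primaryHom_tuple_eq x.1 x.2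
      exact ⟨f, Subtype.ext hf⟩⟩

theorem card_primaryHom_lifts {P Q : Type*} [Group P] [Group Q] [Finite P] [Finite Q]
    {π : P →* Q} (hπ : Function.Surjective π) (hU : p.Coprime (Nat.card π.ker)) {r : ℕ}
    (Y : PrimaryHom p r Q) :
    Nat.card {X : PrimaryHom p r P // π.comp X = Y} = Nat.card π.ker := by
  have hmap : (⊤ : Subgroup P).map π = ⊤ := by
    rw [← MonoidHom.range_eq_map, MonoidHom.range_eq_top.2 hπ]
  have h := card_tupleLifts hU ⊤ Y.tuple Y.tuple_mem (by rw [hmap]; trivial)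
    (fun _ => by rw [hmap]; trivial)
  rw [top_inf_eq] at h
  rw [← h]
  have hcomp : ∀ X : PrimaryHom p r P, π.comp X = Y ↔
      π X.tuple.1 = Y.tuple.1 ∧ ∀ i, π (X.tuple.2 i) = Y.tuple.2 i := fun X => by
    rw [← PrimaryHom.tuple_injective.eq_iff, Prod.ext_iff, funext_iff]
    rfl
  refine Nat.card_congr (Equiv.ofBijective (fun X => ⟨X.1.tuple, X.1.tuple_mem,
    ⟨trivial, fun _ => trivial⟩, (hcomp X.1).1 X.2⟩) ⟨fun X Y h => ?_, fun x => ?_⟩)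
  · exact Subtype.ext (PrimaryHom.tuple_injective (congrArg Subtype.val h))
  · obtain ⟨X, hX⟩ := exists_primaryHom_tuple_eq x.1 x.2.1
    exact ⟨⟨X, (hcomp X).2 (by rw [hX]; exact x.2.2.2)⟩, Subtype.ext hX⟩

/-- Homomorphisms `ℤ × ℤ_p ^ (r - 1) → G` as pairs of a homomorphism from a finite group and an
element that commutes with its values. -/
theorem card_primaryHom_eq [Finite G] (r : ℕ) {N : ℕ}
    (hN : ∀ x : G, (∃ k, x ^ p ^ k = 1) → x ^ p ^ N = 1) :
    Nat.card (PrimaryHom p r G) =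
      Nat.card (Σ z : G, {f : Multiplicative (Fin (r - 1) → ZMod (p ^ N)) →* G //
        ∀ a, z * f a * z⁻¹ = f a}) := by
  have hNe : NeZero (p ^ N) := ⟨pow_ne_zero _ hp.out.ne_zero⟩
  rw [Nat.card_congr (primaryHomEquiv r)]
  have hmem : ∀ x : Σ z : G, {f : Multiplicative (Fin (r - 1) → ZMod (p ^ N)) →* G //
      ∀ a, z * f a * z⁻¹ = f a}, (x.1, fun i => x.2.1 (Multiplicative.ofAdd (Pi.single i 1))) ∈
      primaryTuples p (r - 1) G := by
    refine fun x => ⟨fun i => ⟨N, ?_⟩, fun i => ?_, fun i j => ?_⟩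
    · change x.2.1 _ ^ _ = 1
      rw [← map_pow, ← ofAdd_nsmul, ← Pi.single_smul, nsmul_one, ZMod.natCast_self,
        Pi.single_zero, ofAdd_zero, map_one]
    · exact mul_inv_eq_iff_eq_mul.1 (x.2.2 _)
    · change x.2.1 _ * x.2.1 _ = x.2.1 _ * x.2.1 _
      rw [← map_mul x.2.1, mul_comm, map_mul]
  refine (Nat.card_congr (Equiv.ofBijective (fun x => ⟨_, hmem x⟩) ⟨?_, ?_⟩)).symm
  · rintro ⟨z, f, hf⟩ ⟨w, f', hf'⟩ h
    simp only [Subtype.mk.injEq, Prod.mk.injEq] at h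
    obtain ⟨rfl, h⟩ := h
    have : f = f' := by
      refine MonoidHom.ext fun a => ?_
      let H : AddSubgroup (Fin (r - 1) → ZMod (p ^ N)) := Subgroup.toAddSubgroup' (f.eqLocus f')
      have hH : ∀ i, Pi.single i 1 ∈ H := fun i => congrFun h i
      have ha : a.toAdd = ∑ i, (a.toAdd i).val • Pi.single i (1 : ZMod (p ^ N)) := by
        ext j
        rw [Finset.sum_apply, Finset.sum_eq_single j, Pi.smul_apply, Pi.single_eq_same,
          nsmul_one, ZMod.natCast_zmod_val]
        · intro i _ hij
          rw [Pi.smul_apply, Pi.single_eq_of_ne hij.symm, smul_zero]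
        · simp
      have hmem' : a.toAdd ∈ H := by
        rw [ha]
        exact H.sum_mem fun i _ => H.nsmul_mem (hH i) _
      exact hmem'
    subst this
    rfl
  · rintro ⟨x, hx⟩
    have hx' : ∀ i, x.2 i ^ p ^ N = 1 := fun i => hN _ (hx.1 i)
    have hcomm : ∀ u v, homOfTuple p x hx hx' u + homOfTuple p x hx hx' v =
      homOfTuple p x hx hx' v + homOfTuple p x hx hx' u := fun u v => by
        rw [← map_add, ← map_add, add_comm]
    refine ⟨⟨x.1, AddMonoidHom.toMultiplicativeLeft
      ((homOfTuple p x hx hx').comp (AddMonoidHom.inr _ _)), fun a => ?_⟩, ?_⟩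
    · rw [mul_inv_eq_iff_eq_mul]
      have := hcomm (1, 0) (0, a.toAdd)
      rw [homOfTuple_one_zero] at this
      exact this
    · apply Subtype.ext
      refine Prod.ext rfl (funext fun i => ?_)
      exact homOfTuple_zero_single p x hx hx' i

/-- Conjugation of homomorphisms. -/
@[reducible] def conjHomAction (H G : Type*) [Group H] [Group G] : MulAction G (H →* G) where
  smul g f := (MulAut.conj g).toMonoidHom.comp f
  one_smul f := by ext; simp [HSMul.hSMul]
  mul_smul g h f := by ext; simp [HSMul.hSMul, mul_assoc]

attribute [local instance] conjHomAction

theorem conjHomAction_smul_apply {H : Type*} [Group H] (g : G) (f : H →* G) (a : H) :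
    (g • f) a = g * f a * g⁻¹ := rfl

/-- Burnside's lemma: the pairs of `card_primaryHom_eq` consist of a group element and a
homomorphism fixed by conjugation with it. -/
theorem card_primaryHom_eq_card_orbits [Finite G] (r : ℕ) {N : ℕ}
    (hN : ∀ x : G, (∃ k, x ^ p ^ k = 1) → x ^ p ^ N = 1) :
    Nat.card (PrimaryHom p r G) = Nat.card (Quotient (MulAction.orbitRel G
      (Multiplicative (Fin (r - 1) → ZMod (p ^ N)) →* G))) * Nat.card G := by
  classical
  have hNe : NeZero (p ^ N) := ⟨pow_ne_zero _ hp.out.ne_zero⟩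
  let _ := Fintype.ofFinite G
  have hfin : Finite (Multiplicative (Fin (r - 1) → ZMod (p ^ N)) →* G) :=
    Finite.of_injective (fun f => (f : _ → G)) DFunLike.coe_injective
  let _ := Fintype.ofFinite (Multiplicative (Fin (r - 1) → ZMod (p ^ N)) →* G)
  let _ := Fintype.ofFinite (Quotient (MulAction.orbitRel G
      (Multiplicative (Fin (r - 1) → ZMod (p ^ N)) →* G)))
  rw [Nat.card_eq_fintype_card (α := G), Nat.card_eq_fintype_card (α := Quotient _),
    ← MulAction.sum_card_fixedBy_eq_card_orbits_mul_card_group, card_primaryHom_eq r hN,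
    Nat.card_sigma]
  refine Finset.sum_congr rfl fun z _ => ?_
  rw [← Nat.card_eq_fintype_card]
  refine Nat.card_congr (Equiv.subtypeEquivRight fun f => ?_)
  rw [MulAction.mem_fixedBy, MonoidHom.ext_iff]
  rfl

end PrimaryHomTuples

/-! ### Logarithmic derivatives of formal power series -/

section Series

open PowerSeries

/-- Uniqueness up to a given degree for the differential equation `x A' = T A`. -/
theorem PowerSeries.coeff_eq_of_X_mul_derivative {A B T U : PowerSeries ℚ} {N : ℕ}
    (hA : X * d⁄dX ℚ A = T * A) (hB : X * d⁄dX ℚ B = U * B)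
    (hTU : ∀ k ≤ N, coeff k T = coeff k U) (hT : coeff 0 T = 0)
    (h0 : coeff 0 A = coeff 0 B) : ∀ m ≤ N, coeff m A = coeff m B := by
  -- Because `T` has no constant term, coefficient `m + 1` of `A` depends only on the earlier ones,
  -- and division by `m + 1` is possible over `ℚ`.
  have recur : ∀ A T : PowerSeries ℚ, X * d⁄dX ℚ A = T * A → coeff 0 T = 0 → ∀ m : ℕ,
      ((m : ℚ) + 1) * coeff (m + 1) A =
        ∑ k ∈ Finset.range (m + 1), coeff (k + 1) T * coeff (m - k) A := by
    intro A T h hT m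
    have h1 := congrArg (coeff (m + 1)) h
    rw [coeff_succ_X_mul, coeff_derivative, coeff_mul,
      Finset.Nat.sum_antidiagonal_eq_sum_range_succ_mk, Finset.sum_range_succ'] at h1
    simp only [hT, zero_mul, add_zero, Nat.add_sub_add_right] at h1
    rw [← h1]; ring
  intro m
  induction m using Nat.strong_induction_on with
  | _ m ih =>
    intro hm
    rcases m with _ | m
    · exact h0
    · have h1 := recur _ _ hA hT m
      have h2 := recur _ _ hB (by rw [← hTU 0 (Nat.zero_le _), hT]) m
      have h3 : ((m : ℚ) + 1) ≠ 0 := by positivity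
      apply mul_left_cancel₀ h3
      rw [h1, h2]
      refine Finset.sum_congr rfl fun k hk => ?_
      rw [Finset.mem_range] at hk
      rw [hTU (k + 1) (by omega), ih (m - k) (by omega) (by omega)]

theorem seriesExp_derivative {f : PowerSeries ℚ} (hf : constantCoeff f = 0) :
    d⁄dX ℚ (seriesExp f) = d⁄dX ℚ f * seriesExp f := by
  rw [seriesExp, derivative_subst (HasSubst.of_constantCoeff_zero' hf), derivative_exp, mul_comm]

theorem choose_succ_mul_succ (a : ℚ) (k : ℕ) :
    Ring.choose a (k + 1) * ((k : ℚ) + 1) = (a - k) * Ring.choose a k := by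
  have h1 := Ring.descPochhammer_eq_factorial_smul_choose a (k + 1)
  have h2 := Ring.descPochhammer_eq_factorial_smul_choose a k
  rw [descPochhammer_succ_right, Polynomial.smeval_mul, h2, Polynomial.smeval_sub,
    Polynomial.smeval_X, Polynomial.smeval_natCast, Nat.factorial_succ] at h1
  simp only [nsmul_eq_mul, pow_one, pow_zero, mul_one] at h1
  push_cast at h1
  have h3 : ((k.factorial : ℕ) : ℚ) ≠ 0 := by exact_mod_cast k.factorial_ne_zero
  apply mul_left_cancel₀ h3
  linear_combination -h1

/-- The differential equation of `(1 + x) ^ a`; substituting `f - 1` for `x` makes logarithmic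
derivatives of rational powers computable. -/
theorem binomialSeries_derivative (a : ℚ) :
    (1 + X) * d⁄dX ℚ (PowerSeries.binomialSeries ℚ a) =
      C a * PowerSeries.binomialSeries ℚ a := by
  ext n
  rw [add_mul, one_mul, map_add, coeff_derivative, coeff_C_mul, binomialSeries_coeff,
    binomialSeries_coeff]
  have key := choose_succ_mul_succ a n
  rcases n with _ | n
  · simp at key ⊢
  · rw [coeff_succ_X_mul, coeff_derivative, binomialSeries_coeff]
    simp only [smul_eq_mul, mul_one]
    push_cast at key ⊢
    rw [key]; ring

theorem constantCoeff_seriesPow {f : PowerSeries ℚ} (hf : constantCoeff f = 1) (a : ℚ) :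
    constantCoeff (seriesPow f a) = 1 := by
  have h : constantCoeff ((PowerSeries.binomialSeries ℚ a - 1).subst (f - 1)) = 0 :=
    constantCoeff_subst_eq_zero (by rw [map_sub, map_one]; exact sub_eq_zero.2 hf) _ (by simp)
  have h1 : PowerSeries.binomialSeries ℚ a = (PowerSeries.binomialSeries ℚ a - 1) + 1 := by ring
  have h2 : (1 : PowerSeries ℚ).subst (f - 1) = (1 : PowerSeries ℚ) := by
    rw [← PowerSeries.coe_substAlgHom (seriesPow_hasSubst hf), map_one]
  rw [seriesPow, h1, subst_add (seriesPow_hasSubst hf), h2, map_add, h]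
  simp

theorem constantCoeff_seriesExp {f : PowerSeries ℚ} (hf : constantCoeff f = 0) :
    constantCoeff (seriesExp f) = 1 := by
  have h : constantCoeff ((PowerSeries.exp ℚ - 1).subst f) = 0 :=
    constantCoeff_subst_eq_zero hf _ (by simp)
  have h1 : PowerSeries.exp ℚ = (PowerSeries.exp ℚ - 1) + 1 := by ring
  have h0 := HasSubst.of_constantCoeff_zero' hf
  have h2 : (1 : PowerSeries ℚ).subst f = (1 : PowerSeries ℚ) := by
    rw [← PowerSeries.coe_substAlgHom h0, map_one]
  rw [seriesExp, h1, subst_add h0, h2, map_add, h]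
  simp

theorem X_mul_derivative_seriesPow {f T : PowerSeries ℚ} (hf : constantCoeff f = 1)
    (hT : X * d⁄dX ℚ f = T * f) (a : ℚ) :
    X * d⁄dX ℚ (seriesPow f a) = (C a * T) * seriesPow f a := by
  have h := seriesPow_hasSubst hf
  have h1 : (PowerSeries.subst (f - 1) (1 + PowerSeries.X : PowerSeries ℚ)) = f := by
    rw [PowerSeries.subst_add h, PowerSeries.subst_X h, ← PowerSeries.coe_substAlgHom h, map_one]
    ring
  have h2 := congrArg (PowerSeries.subst (f - 1)) (binomialSeries_derivative a)
  have h3 : (C a : PowerSeries ℚ).subst (f - 1) = (C a : PowerSeries ℚ) := subst_C a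
  rw [subst_mul h, subst_mul h, h1, h3, ← seriesPow] at h2
  have h0 : f ≠ 0 := by rintro rfl; simp at hf
  apply mul_left_cancel₀ h0
  have h4 : d⁄dX ℚ (seriesPow f a) =
      (d⁄dX ℚ (PowerSeries.binomialSeries ℚ a)).subst (f - 1) * d⁄dX ℚ f := by
    rw [seriesPow, derivative_subst h, map_sub, derivative_one, sub_zero]
  rw [h4]
  linear_combination X * d⁄dX ℚ f * h2 + C a * seriesPow f a * hT

theorem X_mul_derivative_mul {A B T U : PowerSeries ℚ} (hA : X * d⁄dX ℚ A = T * A)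
    (hB : X * d⁄dX ℚ B = U * B) : X * d⁄dX ℚ (A * B) = (T + U) * (A * B) := by
  rw [Derivation.leibniz, smul_eq_mul, smul_eq_mul]
  linear_combination B * hA + A * hB

theorem X_mul_derivative_pow {A T : PowerSeries ℚ} (hA : X * d⁄dX ℚ A = T * A) (n : ℕ) :
    X * d⁄dX ℚ (A ^ n) = ((n : PowerSeries ℚ) * T) * A ^ n := by
  induction n with
  | zero => simp
  | succ n ih =>
    rw [pow_succ, X_mul_derivative_mul ih hA]
    push_cast
    ring

theorem X_mul_derivative_inv {A T : PowerSeries ℚ} (h0 : constantCoeff A = 1)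
    (hA : X * d⁄dX ℚ A = T * A) : X * d⁄dX ℚ A⁻¹ = (-T) * A⁻¹ := by
  have h : A * A⁻¹ = 1 := PowerSeries.mul_inv_cancel A (by simp [h0])
  rw [derivative_inv']
  linear_combination (-(A⁻¹) ^ 2) * hA - T * A⁻¹ * h

theorem X_mul_derivative_prod {ι : Type*} {A T : ι → PowerSeries ℚ} (s : Finset ι)
    (hA : ∀ i, X * d⁄dX ℚ (A i) = T i * A i) :
    X * d⁄dX ℚ (∏ i ∈ s, A i) = (∑ i ∈ s, T i) * ∏ i ∈ s, A i := by
  classical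
  induction s using Finset.induction_on with
  | empty => simp
  | insert i s hi ih =>
    rw [Finset.prod_insert hi, Finset.sum_insert hi, X_mul_derivative_mul (hA i) ih]

/-- The logarithmic derivative of `1 - x ^ m`. -/
theorem X_mul_derivative_one_sub_X_pow {m : ℕ} (hm : 0 < m) :
    X * d⁄dX ℚ (1 - X ^ m : PowerSeries ℚ) =
      PowerSeries.mk (fun j => if j ≠ 0 ∧ m ∣ j then -(m : ℚ) else 0) * (1 - X ^ m) := by
  obtain ⟨k, rfl⟩ : ∃ k, m = k + 1 := ⟨m - 1, by omega⟩
  have h1 : X * d⁄dX ℚ (1 - X ^ (k + 1) : PowerSeries ℚ) = C (-((k + 1 : ℕ) : ℚ)) * X ^ (k + 1) := by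
    rw [map_sub, derivative_one, derivative_pow, derivative_X, map_neg, map_natCast,
      Nat.add_sub_cancel]
    ring
  rw [h1]
  ext j
  rw [mul_sub, mul_one, map_sub, coeff_C_mul, coeff_X_pow, coeff_mul_X_pow', coeff_mk]
  by_cases hj : k + 1 ≤ j
  · obtain ⟨i, rfl⟩ := Nat.exists_eq_add_of_le hj
    rcases eq_or_ne i 0 with rfl | hi
    · simp
    · simp [hi, coeff_mk]
  · have h2 : ¬ (j ≠ 0 ∧ k + 1 ∣ j) := fun h =>
      hj (Nat.le_of_dvd (Nat.pos_of_ne_zero h.1) h.2)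
    rw [if_neg h2, if_neg hj, if_neg (by omega)]
    simp

end Series

/-! ### The product formula and divisibility of coefficients -/

noncomputable section PrimaryWeights

open PowerSeries

/-- The series `∑_{n ≥ 1} p ^ (s (1 + e + ν_p(n))) x ^ n`. -/
def primaryWeights (p s e : ℕ) : PowerSeries ℚ :=
  PowerSeries.mk fun n => if n = 0 then 0 else (p : ℚ) ^ (s * (1 + e + padicValNat p n))

theorem coeff_zero_primaryWeights (p s e : ℕ) : coeff 0 (primaryWeights p s e) = 0 := by
  simp [primaryWeights]

theorem eq_of_X_mul_derivative {A B T : PowerSeries ℚ}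
    (hA : X * d⁄dX ℚ A = T * A) (hB : X * d⁄dX ℚ B = T * B) (hT : coeff 0 T = 0)
    (h0 : coeff 0 A = coeff 0 B) : A = B := by
  ext m
  exact coeff_eq_of_X_mul_derivative hA hB (fun _ _ => rfl) hT h0 m le_rfl

/-- Both sides solve the same equation, since `x d/dx` cancels the denominators `n` in the exponent.
-/
theorem eq_seriesExp_of_X_mul_derivative {F : PowerSeries ℚ} {t : ℕ → ℚ} (h0 : coeff 0 F = 1)
    (hF : X * d⁄dX ℚ F = (-PowerSeries.mk fun n => if n = 0 then 0 else t n) * F) :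
    F = seriesExp (-PowerSeries.mk fun n => if n = 0 then (0 : ℚ) else t n / (n : ℚ)) := by
  have hc : constantCoeff
      (-PowerSeries.mk fun n => if n = 0 then (0 : ℚ) else t n / (n : ℚ)) = 0 := by
    rw [map_neg, ← coeff_zero_eq_constantCoeff_apply, coeff_mk]
    simp
  refine eq_of_X_mul_derivative hF ?_ (by simp) ?_
  · rw [seriesExp_derivative hc, ← mul_assoc]
    congr 1
    ext n
    rcases n with _ | n
    · simp
    · rw [coeff_succ_X_mul, coeff_derivative]
      simp only [map_neg, coeff_mk, Nat.add_eq_zero_iff, one_ne_zero, and_false, if_false]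
      have : ((n : ℚ) + 1) ≠ 0 := by positivity
      push_cast
      field_simp
  · rw [h0, coeff_zero_eq_constantCoeff_apply, constantCoeff_seriesExp hc]

/-- The factors `(1 - x ^ (p ^ n)) ^ p / (1 - x ^ (p ^ (n + 1)))` of the product formula. -/
def primaryFactor (p n : ℕ) : PowerSeries ℚ :=
  (1 - PowerSeries.X ^ p ^ n) ^ p * (1 - PowerSeries.X ^ p ^ (n + 1))⁻¹

variable {p : ℕ} [hp : Fact p.Prime]

theorem constantCoeff_one_sub_X_pow {m : ℕ} (hm : m ≠ 0) :
    constantCoeff (1 - X ^ m : PowerSeries ℚ) = 1 := by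
  simp [hm]

theorem constantCoeff_primaryFactor (n : ℕ) : constantCoeff (primaryFactor p n) = 1 := by
  have h := fun n => constantCoeff_one_sub_X_pow (pow_ne_zero n hp.out.ne_zero)
  rw [primaryFactor, map_mul, map_pow, h, constantCoeff_inv, h]
  simp

/-- The numerator contributes `-p * p ^ n` when `p ^ n ∣ j`, the denominator `p ^ (n + 1)` when `p ^
(n + 1) ∣ j`. They cancel unless the valuation of `j` is exactly `n`. -/
theorem X_mul_derivative_primaryFactor (n : ℕ) :
    X * d⁄dX ℚ (primaryFactor p n) = (PowerSeries.mk fun j =>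
      if j ≠ 0 ∧ padicValNat p j = n then -(p : ℚ) ^ (n + 1) else 0) * primaryFactor p n := by
  have hpos := fun n => pow_pos hp.out.pos n
  rw [primaryFactor, X_mul_derivative_mul
    (X_mul_derivative_pow (X_mul_derivative_one_sub_X_pow (hpos n)) p)
    (X_mul_derivative_inv (constantCoeff_one_sub_X_pow (hpos (n + 1)).ne')
      (X_mul_derivative_one_sub_X_pow (hpos (n + 1))))]
  congr 1
  ext j
  rw [map_add, map_neg, coeff_mk, coeff_mk, ← map_natCast (C (R := ℚ)), coeff_C_mul, coeff_mk]
  rcases eq_or_ne j 0 with rfl | hj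
  · simp
  · have h1 : ∀ k, p ^ k ∣ j ↔ k ≤ padicValNat p j := fun k => padicValNat_dvd_iff_le hj
    simp only [ne_eq, hj, not_false_eq_true, true_and, h1]
    push_cast
    rcases lt_trichotomy (padicValNat p j) n with h | h | h
    · rw [if_neg (by omega), if_neg (by omega), if_neg (by omega)]; simp
    · rw [if_pos (by omega), if_neg (by omega), if_pos h]; ring
    · rw [if_pos (by omega), if_pos (by omega), if_neg (by omega)]; ring

/-- Here `s` plays the role of `r - 1`. The exponents fit because `(s - 1)(n + 1) + s e + (n + 1) =
s (1 + e + n)`. -/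
theorem X_mul_derivative_prod_primaryFactor (s e : ℕ) (S : Finset ℕ) :
    X * d⁄dX ℚ (∏ n ∈ S, seriesPow (primaryFactor p n)
        ((p : ℚ) ^ (((s : ℤ) - 1) * ((n : ℤ) + 1) + (s : ℤ) * (e : ℤ)))) =
      (-PowerSeries.mk fun j => if j ≠ 0 ∧ padicValNat p j ∈ S then
        (p : ℚ) ^ (s * (1 + e + padicValNat p j)) else 0) *
      ∏ n ∈ S, seriesPow (primaryFactor p n)
        ((p : ℚ) ^ (((s : ℤ) - 1) * ((n : ℤ) + 1) + (s : ℤ) * (e : ℤ))) := by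
  rw [X_mul_derivative_prod S fun n => X_mul_derivative_seriesPow (constantCoeff_primaryFactor n)
    (X_mul_derivative_primaryFactor n) _]
  congr 1
  ext j
  simp only [map_sum, coeff_C_mul, coeff_mk, map_neg]
  rcases eq_or_ne j 0 with rfl | hj
  · simp
  · simp only [ne_eq, hj, not_false_eq_true, true_and, mul_ite, mul_zero, Finset.sum_ite_eq]
    split_ifs with h
    · have hp0 : (p : ℚ) ≠ 0 := by exact_mod_cast hp.out.ne_zero
      rw [mul_neg, ← zpow_natCast, ← zpow_natCast, ← zpow_add₀ hp0]
      congr 2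
      push_cast
      ring
    · simp

theorem coeff_prod_primaryFactor {s e : ℕ} {F : PowerSeries ℚ} (h0 : coeff 0 F = 1)
    (hF : X * d⁄dX ℚ F = (-primaryWeights p s e) * F) {m : ℕ} {S : Finset ℕ}
    (hS : Finset.range (m + 1) ⊆ S) :
    coeff m (∏ n ∈ S, seriesPow (primaryFactor p n)
        ((p : ℚ) ^ (((s : ℤ) - 1) * ((n : ℤ) + 1) + (s : ℤ) * (e : ℤ)))) = coeff m F := by
  refine coeff_eq_of_X_mul_derivative (N := m) (X_mul_derivative_prod_primaryFactor s e S) hF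
    ?_ (by simp) ?_ m le_rfl
  · intro k hk
    rw [primaryWeights, map_neg, map_neg, coeff_mk, coeff_mk]
    rcases eq_or_ne k 0 with rfl | hk0
    · simp
    -- Valuations of indices up to `m` are at most `m`, so the factors with `n ≤ m` already account
    -- for every weight up to degree `m`.
    · have h1 : padicValNat p k ∈ S := hS <| Finset.mem_range.2 <| by
        have h2 : p ^ padicValNat p k ≤ k :=
          Nat.le_of_dvd (Nat.pos_of_ne_zero hk0) pow_padicValNat_dvd
        have h3 := Nat.lt_pow_self hp.out.one_lt (n := padicValNat p k)
        omega
      simp [hk0, h1]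
  · rw [h0, coeff_zero_eq_constantCoeff_apply, map_prod]
    exact Finset.prod_eq_one fun n _ => constantCoeff_seriesPow (constantCoeff_primaryFactor n) _

/-- Power series with integral coefficients that are congruent to `1` modulo `d`. -/
def onePlusMul (d : ℕ) : Submonoid (PowerSeries ℚ) where
  carrier := {f | ∃ u : PowerSeries ℤ, f = 1 + (d : PowerSeries ℚ) * u.map (Int.castRingHom ℚ)}
  one_mem' := ⟨0, by simp⟩
  mul_mem' := by
    rintro _ _ ⟨u, rfl⟩ ⟨v, rfl⟩
    refine ⟨u + v + (d : PowerSeries ℤ) * u * v, ?_⟩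
    simp only [map_add, map_mul, map_natCast]
    ring

theorem exists_coeff_of_mem_onePlusMul {d : ℕ} {f : PowerSeries ℚ} (hf : f ∈ onePlusMul d)
    {n : ℕ} (hn : n ≠ 0) : ∃ m : ℤ, coeff n f = d * m := by
  obtain ⟨u, rfl⟩ := hf
  refine ⟨coeff n u, ?_⟩
  rw [map_add, coeff_one, if_neg hn, ← map_natCast (C (R := ℚ)), coeff_C_mul, coeff_map]
  simp

theorem onePlusMul_mono {d d' : ℕ} (h : d ∣ d') : onePlusMul d' ≤ onePlusMul d := by
  obtain ⟨c, rfl⟩ := h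
  rintro _ ⟨u, rfl⟩
  exact ⟨(c : PowerSeries ℤ) * u, by simp [mul_assoc]⟩

/-- In `f ^ p - 1 = (f - 1) (1 + f + ⋯ + f ^ (p - 1))` the second factor is congruent to `p`, hence
to `0`, modulo `p`; this uses `k ≥ 1`. -/
theorem pow_mem_onePlusMul {p k : ℕ} (hk : 1 ≤ k) {f : PowerSeries ℚ}
    (hf : f ∈ onePlusMul (p ^ k)) : f ^ p ∈ onePlusMul (p ^ (k + 1)) := by
  obtain ⟨u, rfl⟩ := hf
  have key : ((p : PowerSeries ℤ) ^ (k + 1)) ∣ (1 + (p : PowerSeries ℤ) ^ k * u) ^ p - 1 := by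
    have h1 : (1 + (p : PowerSeries ℤ) ^ k * u - 1) ∣ (1 + (p : PowerSeries ℤ) ^ k * u) ^ p - 1 := by
      simpa using sub_dvd_pow_sub_pow (1 + (p : PowerSeries ℤ) ^ k * u) 1 p
    rw [← mul_geom_sum, add_sub_cancel_left, pow_succ, mul_assoc]
    refine mul_dvd_mul_left _ (Dvd.dvd.mul_left ?_ _)
    have h3 : ∀ i, (p : PowerSeries ℤ) ∣ (1 + (p : PowerSeries ℤ) ^ k * u) ^ i - 1 := by
      intro i
      refine dvd_trans ?_ (by simpa using sub_dvd_pow_sub_pow (1 + (p : PowerSeries ℤ) ^ k * u) 1 i)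
      exact Dvd.dvd.mul_right (dvd_pow_self _ (by omega)) _
    have h4 : ∑ i ∈ Finset.range p, (1 + (p : PowerSeries ℤ) ^ k * u) ^ i =
        ∑ i ∈ Finset.range p, ((1 + (p : PowerSeries ℤ) ^ k * u) ^ i - 1) + p := by
      simp
    rw [h4]
    exact dvd_add (Finset.dvd_sum fun i _ => h3 i) dvd_rfl
  obtain ⟨v, hv⟩ := key
  refine ⟨v, ?_⟩
  have := congrArg (PowerSeries.map (Int.castRingHom ℚ)) hv
  simp only [map_sub, map_pow, map_add, map_mul, map_one, map_natCast] at this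
  push_cast
  linear_combination this

theorem pow_pow_mem_onePlusMul {p : ℕ} {f : PowerSeries ℚ} (hf : f ∈ onePlusMul p) (a : ℕ) :
    f ^ p ^ a ∈ onePlusMul (p ^ (a + 1)) := by
  induction a with
  | zero => simpa using hf
  | succ a ih =>
    rw [pow_succ p a, pow_mul]
    exact pow_mem_onePlusMul (by omega) ih

theorem primaryFactor_mem_onePlusMul (n : ℕ) : primaryFactor p n ∈ onePlusMul p := by
  have hq : p ^ (n + 1) ≠ 0 := pow_ne_zero _ hp.out.ne_zero
  have h1 : ∃ v : PowerSeries ℤ, (1 - X ^ p ^ (n + 1)) * v = 1 := by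
    refine ⟨invOfUnit (1 - X ^ p ^ (n + 1)) 1, mul_invOfUnit _ _ (by simp [hp.out.ne_zero])⟩
  obtain ⟨v, hv⟩ := h1
  -- The Frobenius identity modulo `p`, checked on polynomials over `ZMod p` and transported to
  -- power series.
  have h2 : (p : PowerSeries ℤ) ∣ (1 - X ^ p ^ n) ^ p - (1 - X ^ p ^ (n + 1)) := by
    have h3 : (((1 - Polynomial.X ^ p ^ n) ^ p - (1 - Polynomial.X ^ p ^ (n + 1)) :
        Polynomial ℤ)).map (Int.castRingHom (ZMod p)) = 0 := by
      simp only [Polynomial.map_sub, Polynomial.map_pow, Polynomial.map_one, Polynomial.map_X]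
      rw [sub_pow_char, one_pow, ← pow_mul, ← pow_succ, sub_self]
    have h4 : (p : Polynomial ℤ) ∣
        ((1 - Polynomial.X ^ p ^ n) ^ p - (1 - Polynomial.X ^ p ^ (n + 1)) : Polynomial ℤ) := by
      rw [← map_natCast (Polynomial.C (R := ℤ)), Polynomial.C_dvd_iff_dvd_coeff]
      intro i
      rw [← ZMod.intCast_zmod_eq_zero_iff_dvd _ p]
      have := congrArg (fun P => Polynomial.coeff P i) h3
      simpa only [Polynomial.coeff_map, Polynomial.coeff_zero, eq_intCast] using this
    have h5 := map_dvd (Polynomial.coeToPowerSeries.ringHom (R := ℤ)) h4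
    simpa using h5
  obtain ⟨w, hw⟩ := h2
  refine ⟨w * v, ?_⟩
  have hv' := congrArg (PowerSeries.map (Int.castRingHom ℚ)) hv
  have hw' := congrArg (PowerSeries.map (Int.castRingHom ℚ)) hw
  simp only [map_sub, map_pow, map_mul, map_one, map_natCast, map_X] at hv' hw'
  have h6 : (1 - X ^ p ^ (n + 1) : PowerSeries ℚ)⁻¹ = v.map (Int.castRingHom ℚ) := by
    rw [PowerSeries.inv_eq_iff_mul_eq_one (by simp [hp.out.ne_zero]), mul_comm]
    exact hv'
  rw [primaryFactor, h6, map_mul]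
  linear_combination v.map (Int.castRingHom ℚ) * hw' + hv'

/-- For `s = 0` all weights are `1` and `F = 1 - x`. For `s > 0` the exponents are powers `p ^ a`
with `a ≥ 0`, and a power `p ^ a` of a series in `1 + p ℤ[[x]]` lies in `1 + p ^ (a + 1) ℤ[[x]]`. -/
theorem exists_coeff_eq_of_X_mul_derivative {s e : ℕ} {F : PowerSeries ℚ} (h0 : coeff 0 F = 1)
    (hF : X * d⁄dX ℚ F = (-primaryWeights p s e) * F) {m : ℕ} (hm : m ≠ 0) :
    ∃ z : ℤ, coeff m F = (p : ℚ) ^ (s * (1 + e)) * z := by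
  rcases Nat.eq_zero_or_pos s with rfl | hs
  · have h1 : F = 1 - X ^ 1 := by
      refine eq_of_X_mul_derivative hF ?_ (by simp [primaryWeights]) (by simp [h0])
      rw [X_mul_derivative_one_sub_X_pow one_pos]
      congr 1
      ext j
      simp only [primaryWeights, coeff_mk, map_neg]
      split_ifs <;> simp_all
    refine ⟨coeff m (1 - X ^ 1 : PowerSeries ℤ), ?_⟩
    rw [h1, zero_mul, pow_zero, one_mul, map_sub, map_sub, coeff_X_pow, coeff_X_pow, coeff_one,
      coeff_one]
    push_cast
    rfl
  · rw [← coeff_prod_primaryFactor h0 hF subset_rfl]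
    have h2 : ∏ n ∈ Finset.range (m + 1), seriesPow (primaryFactor p n)
        ((p : ℚ) ^ (((s : ℤ) - 1) * ((n : ℤ) + 1) + (s : ℤ) * (e : ℤ))) ∈
        onePlusMul (p ^ (s * (1 + e))) := by
      refine Submonoid.prod_mem _ fun n _ => ?_
      obtain ⟨s, rfl⟩ : ∃ k, s = k + 1 := ⟨s - 1, by omega⟩
      have h3 : ((p : ℚ) ^ ((((s + 1 : ℕ) : ℤ) - 1) * ((n : ℤ) + 1) +
          ((s + 1 : ℕ) : ℤ) * (e : ℤ))) = ((p ^ (s * (n + 1) + (s + 1) * e) : ℕ) : ℚ) := by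
        rw [Nat.cast_pow, ← zpow_natCast]
        congr 1
        push_cast
        ring
      rw [h3, seriesPow_natCast (constantCoeff_primaryFactor n)]
      -- The required bound `a + 1 ≥ s (1 + e)` is an equality for the factor `n = 0`.
      refine onePlusMul_mono (pow_dvd_pow p ?_)
        (pow_pow_mem_onePlusMul (primaryFactor_mem_onePlusMul n) _)
      nlinarith [Nat.zero_le (s * n)]
    obtain ⟨z, hz⟩ := exists_coeff_of_mem_onePlusMul h2 hm
    exact ⟨z, by rw [hz]; push_cast; ring⟩

end PrimaryWeights

/-! ### Parabolic subgroups and their Levi quotients -/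

noncomputable section Parabolic

variable {F V : Type*} [Field F] [AddCommGroup V] [Module F V]

/-- The stabilizer of a subspace. -/
def parabolic (W : Submodule F V) : Subgroup (V ≃ₗ[F] V) where
  carrier := {g | W.map (g : V →ₗ[F] V) = W}
  one_mem' := Submodule.map_id W
  mul_mem' := by
    intro g h hg hh
    change W.map ((g : V →ₗ[F] V) ∘ₗ (h : V →ₗ[F] V)) = W
    rw [Submodule.map_comp, hh, hg]
  inv_mem' := by
    intro g hg
    have h1 : (W.map (g : V →ₗ[F] V)).map ((g⁻¹ : V ≃ₗ[F] V) : V →ₗ[F] V) = W := by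
      rw [← Submodule.map_comp]
      convert Submodule.map_id W
      ext x
      exact g.symm_apply_apply x
    rw [hg] at h1
    exact h1

theorem mem_parabolic_of_le [FiniteDimensional F V] {W : Submodule F V} {g : V ≃ₗ[F] V}
    (h : ∀ w ∈ W, g w ∈ W) : g ∈ parabolic W := by
  refine Submodule.eq_of_le_of_finrank_eq (Submodule.map_le_iff_le_comap.2 h) ?_
  exact LinearEquiv.finrank_map_eq g W

/-- The restriction of the stabilizer of a subspace to the subspace. -/
def parabolicRestrict (W : Submodule F V) : parabolic W →* (W ≃ₗ[F] W) where
  toFun g := g.1.ofSubmodules W W g.2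
  map_one' := by ext; rfl
  map_mul' g h := by ext; rfl

/-- The action of the stabilizer of a subspace on the quotient space. -/
def parabolicQuotient (W : Submodule F V) : parabolic W →* ((V ⧸ W) ≃ₗ[F] (V ⧸ W)) where
  toFun g := Submodule.Quotient.equiv W W g.1 g.2
  map_one' := by
    ext x
    obtain ⟨x, rfl⟩ := Submodule.Quotient.mk_surjective W x
    rfl
  map_mul' g h := by
    ext x
    obtain ⟨x, rfl⟩ := Submodule.Quotient.mk_surjective W x
    rfl

@[simp] theorem parabolicQuotient_mk (W : Submodule F V) (g : parabolic W) (v : V) :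
    parabolicQuotient W g (Submodule.Quotient.mk v) = Submodule.Quotient.mk (g.1 v) := rfl

/-- The map from a parabolic subgroup to its Levi quotient. -/
def parabolicToLevi (W : Submodule F V) :
    parabolic W →* (W ≃ₗ[F] W) × ((V ⧸ W) ≃ₗ[F] (V ⧸ W)) :=
  (parabolicRestrict W).prod (parabolicQuotient W)

/-- A complement of `W` gives a block-diagonal section of the Levi quotient. -/
theorem parabolicToLevi_surjective (W : Submodule F V) :
    Function.Surjective (parabolicToLevi W) := by
  rintro ⟨a, c⟩
  obtain ⟨W', hW⟩ := Submodule.exists_isCompl W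
  let φ := Submodule.prodEquivOfIsCompl W W' hW
  let ψ := Submodule.quotientEquivOfIsCompl W W' hW
  let g : V ≃ₗ[F] V := φ.symm ≪≫ₗ (a.prodCongr (ψ.symm ≪≫ₗ c ≪≫ₗ ψ)) ≪≫ₗ φ
  have hg1 : ∀ w : W, g w = a w := fun w => by
    change φ ((a.prodCongr (ψ.symm ≪≫ₗ c ≪≫ₗ ψ)) (φ.symm w)) = _
    rw [Submodule.prodEquivOfIsCompl_symm_apply_left]
    simp [φ]
  have hg2 : ∀ w : W', g w = ψ (c (Submodule.Quotient.mk (w : V))) := fun w => by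
    change φ ((a.prodCongr (ψ.symm ≪≫ₗ c ≪≫ₗ ψ)) (φ.symm w)) = _
    rw [Submodule.prodEquivOfIsCompl_symm_apply_right]
    simp [φ, ψ]
  have hg : g ∈ parabolic W := by
    apply le_antisymm
    · rintro _ ⟨w, hw, rfl⟩
      have := hg1 ⟨w, hw⟩
      simp only at this
      rw [LinearEquiv.coe_coe, this]
      exact (a _).2
    · intro w hw
      refine ⟨a.symm ⟨w, hw⟩, (a.symm ⟨w, hw⟩).2, ?_⟩
      rw [LinearEquiv.coe_coe, hg1, LinearEquiv.apply_symm_apply]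
  refine ⟨⟨g, hg⟩, Prod.ext ?_ ?_⟩
  · ext w
    exact hg1 w
  · ext x
    obtain ⟨x, rfl⟩ := ψ.symm.surjective x
    have h1 : ψ.symm x = Submodule.Quotient.mk (x : V) := by
      simp [ψ]
    rw [h1]
    change Submodule.Quotient.mk (g x) = _
    rw [hg2, ← Submodule.quotientEquivOfIsCompl_symm_apply W W' hW, LinearEquiv.symm_apply_apply]

theorem mem_ker_parabolicToLevi {W : Submodule F V} {g : parabolic W}
    (hg : g ∈ (parabolicToLevi W).ker) : (∀ w ∈ W, g.1 w = w) ∧ ∀ v, g.1 v - v ∈ W := by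
  rw [MonoidHom.mem_ker, parabolicToLevi, MonoidHom.prod_apply, Prod.mk_eq_one] at hg
  refine ⟨fun w hw => ?_, fun v => ?_⟩
  · exact congrArg Subtype.val (DFunLike.congr_fun hg.1 ⟨w, hw⟩)
  · have := DFunLike.congr_fun hg.2 (Submodule.Quotient.mk v)
    rw [parabolicQuotient_mk] at this
    exact (Submodule.Quotient.eq W).1 this

/-- In the kernel `g - 1` has square zero, so `g ^ n = 1 + n (g - 1)`, and `g ^ l = 1` in
characteristic `l`. -/
theorem isPGroup_ker_parabolicToLevi (l : ℕ) [CharP F l] (W : Submodule F V) :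
    IsPGroup l (parabolicToLevi W).ker := by
  rintro ⟨g, hg⟩
  obtain ⟨h1, h2⟩ := mem_ker_parabolicToLevi hg
  refine ⟨1, ?_⟩
  have h3 : ∀ (n : ℕ) v, (g ^ n).1 v = v + n • (g.1 v - v) := by
    intro n v
    induction n with
    | zero => simp
    | succ n ih =>
      rw [pow_succ']
      change g.1 ((g ^ n).1 v) = _
      rw [ih, map_add, map_nsmul, h1 _ (h2 v)]
      simp only [add_smul, one_smul]
      abel
  rw [pow_one]
  apply Subtype.ext
  apply Subtype.ext
  ext v
  change (g ^ l).1 v = v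
  rw [h3, ← Nat.cast_smul_eq_nsmul F, CharP.cast_eq_zero, zero_smul, add_zero]

end Parabolic

/-! ### Orders of parabolic subgroups and numbers of subspaces -/

section Counting

variable {F V : Type*} [Field F] [AddCommGroup V] [Module F V]

instance finite_linearEquiv [Finite V] : Finite (V ≃ₗ[F] V) :=
  Finite.of_injective (fun g => (g : V → V)) DFunLike.coe_injective

theorem coprime_card_ker_parabolicToLevi [Finite V] {p l : ℕ} (hp : p.Prime) (hl : l.Prime)
    (hpl : p ≠ l) [CharP F l] (W : Submodule F V) :
    p.Coprime (Nat.card (parabolicToLevi W).ker) := by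
  have := Fact.mk hl
  obtain ⟨n, hn⟩ := IsPGroup.iff_card.1 (isPGroup_ker_parabolicToLevi l W)
  rw [hn]
  exact ((Nat.coprime_primes hp hl).2 hpl).pow_right n

theorem card_parabolic [Finite V] (W : Submodule F V) :
    Nat.card (parabolic W) = Nat.card (parabolicToLevi W).ker *
      (Nat.card (W ≃ₗ[F] W) * Nat.card ((V ⧸ W) ≃ₗ[F] (V ⧸ W))) := by
  rw [← Nat.card_prod, ← Subgroup.card_mul_index (parabolicToLevi W).ker, Subgroup.index_ker,
    MonoidHom.range_eq_top.2 (parabolicToLevi_surjective W), Subgroup.card_top]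

theorem exists_map_eq_of_finrank_eq [FiniteDimensional F V] {W W' : Submodule F V}
    (h : Module.finrank F W = Module.finrank F W') :
    ∃ g : V ≃ₗ[F] V, W.map (g : V →ₗ[F] V) = W' := by
  obtain ⟨C, hC⟩ := Submodule.exists_isCompl W
  obtain ⟨C', hC'⟩ := Submodule.exists_isCompl W'
  have h1 := Submodule.finrank_add_eq_of_isCompl hC
  have h2 := Submodule.finrank_add_eq_of_isCompl hC'
  obtain ⟨a⟩ := FiniteDimensional.nonempty_linearEquiv_of_finrank_eq h
  obtain ⟨c⟩ := FiniteDimensional.nonempty_linearEquiv_of_finrank_eq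
    (show Module.finrank F C = Module.finrank F C' by omega)
  let g : V ≃ₗ[F] V := (Submodule.prodEquivOfIsCompl W C hC).symm ≪≫ₗ (a.prodCongr c) ≪≫ₗ
    Submodule.prodEquivOfIsCompl W' C' hC'
  refine ⟨g, Submodule.eq_of_le_of_finrank_eq ?_ ?_⟩
  · rintro _ ⟨w, hw, rfl⟩
    change Submodule.prodEquivOfIsCompl W' C' hC' ((a.prodCongr c)
      ((Submodule.prodEquivOfIsCompl W C hC).symm (⟨w, hw⟩ : W))) ∈ _
    rw [Submodule.prodEquivOfIsCompl_symm_apply_left]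
    simp
  · rw [← h]
    exact LinearEquiv.finrank_map_eq g W

/-- Orbit-stabilizer for the general linear group acting on subspaces: the orbits are the sets of
subspaces of a given dimension. -/
theorem card_finrank_eq_mul_card_parabolic [Finite V] (W : Submodule F V) :
    Nat.card {W' : Submodule F V // Module.finrank F W' = Module.finrank F W} *
      Nat.card (parabolic W) = Nat.card (V ≃ₗ[F] V) := by
  let _ : MulAction (V ≃ₗ[F] V) (Submodule F V) :=
    { smul := fun g W => W.map (g : V →ₗ[F] V)
      one_smul := fun W => Submodule.map_id W
      mul_smul := fun g h W => Submodule.map_comp (h : V →ₗ[F] V) (g : V →ₗ[F] V) W }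
  have h1 : MulAction.orbit (V ≃ₗ[F] V) W =
      {W' : Submodule F V | Module.finrank F W' = Module.finrank F W} := by
    ext W'
    constructor
    · rintro ⟨g, rfl⟩
      exact LinearEquiv.finrank_map_eq g W
    · intro h
      obtain ⟨g, hg⟩ := exists_map_eq_of_finrank_eq (Eq.symm h)
      exact ⟨g, hg⟩
  have h2 := Nat.card_congr (MulAction.orbitProdStabilizerEquivGroup (V ≃ₗ[F] V) W)
  rw [Nat.card_prod, h1] at h2
  exact h2

theorem exists_submodule_finrank_eq [FiniteDimensional F V] {k : ℕ}
    (hk : k ≤ Module.finrank F V) : ∃ W : Submodule F V, Module.finrank F W = k := by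
  obtain ⟨f, hf⟩ := exists_linearIndependent_of_le_finrank hk
  exact ⟨Submodule.span F (Set.range f), by simpa using finrank_span_eq_card hf⟩

end Counting

/-! ### Euler characteristics of posets of invariant subspaces -/

noncomputable section EquivariantChar

variable {A F V V' : Type*} [Group A] [Field F] [AddCommGroup V] [Module F V]
  [AddCommGroup V'] [Module F V']

/-- The subspaces that are fixed by a group of automorphisms. -/
def Stabilizes (X : A →* (V ≃ₗ[F] V)) (W : Submodule F V) : Prop :=
  ∀ a, W.map (X a : V →ₗ[F] V) = W

theorem stabilizes_of_le [FiniteDimensional F V] {X : A →* (V ≃ₗ[F] V)} {W : Submodule F V}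
    (h : ∀ a, ∀ w ∈ W, X a w ∈ W) : Stabilizes X W := fun a => mem_parabolic_of_le (h a)

theorem Stabilizes.apply_mem {X : A →* (V ≃ₗ[F] V)} {W : Submodule F V} (h : Stabilizes X W)
    (a : A) {w : V} (hw : w ∈ W) : X a w ∈ W := by
  rw [← h a]
  exact ⟨w, hw, rfl⟩

theorem stabilizes_bot (X : A →* (V ≃ₗ[F] V)) : Stabilizes X ⊥ := fun _ => Submodule.map_bot _

theorem stabilizes_top (X : A →* (V ≃ₗ[F] V)) : Stabilizes X ⊤ := fun a => by
  rw [Submodule.map_top, LinearEquiv.range]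

/-- The restriction of a representation to an invariant subspace. -/
def Stabilizes.restrict {X : A →* (V ≃ₗ[F] V)} {W : Submodule F V} (h : Stabilizes X W) :
    A →* (W ≃ₗ[F] W) :=
  (parabolicRestrict W).comp (X.codRestrict (parabolic W) h)

/-- The reduced Euler characteristic of the poset of invariant subspaces, with the value `1` on
the zero representation. -/
def equivariantChar (X : A →* (V ≃ₗ[F] V)) : ℤ :=
  if Module.finrank F V = 0 then 1
  else reducedEulerChar {W : Submodule F V // W ≠ ⊥ ∧ W ≠ ⊤ ∧ Stabilizes X W}

theorem equivariantChar_congr [FiniteDimensional F V] [FiniteDimensional F V']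
    {X : A →* (V ≃ₗ[F] V)} {X' : A →* (V' ≃ₗ[F] V')}
    (e : V ≃ₗ[F] V') (h : ∀ a v, e (X a v) = X' a (e v)) :
    equivariantChar X = equivariantChar X' := by
  rw [equivariantChar, equivariantChar, e.finrank_eq]
  congr 1
  refine reducedEulerChar_congr
    ⟨(Submodule.orderIsoMapComap e).toEquiv.subtypeEquiv fun W => ?_,
      (Submodule.orderIsoMapComap e).map_rel_iff⟩
  have h1 : (Submodule.orderIsoMapComap e).toEquiv W = W.map (e : V →ₗ[F] V') := rfl
  refine and_congr ?_ (and_congr ?_ ?_)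
  · exact not_congr (map_eq_bot_iff (Submodule.orderIsoMapComap e)).symm
  · exact not_congr (map_eq_top_iff (Submodule.orderIsoMapComap e)).symm
  · rw [h1]
    constructor
    · intro hW
      refine stabilizes_of_le fun a => ?_
      rintro _ ⟨w, hw, rfl⟩
      exact ⟨X a w, hW.apply_mem a hw, h a w⟩
    · intro hW
      refine stabilizes_of_le fun a w hw => ?_
      obtain ⟨w', hw', h2⟩ := hW.apply_mem a ⟨w, hw, rfl⟩
      have h3 : e w' = e (X a w) := by rw [h]; exact h2
      rwa [← e.injective h3]

/-- The invariant subspaces of an invariant subspace. -/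
def Stabilizes.orderIso [FiniteDimensional F V] {X : A →* (V ≃ₗ[F] V)} {W : Submodule F V}
    (h : Stabilizes X W) :
    {W' : Submodule F V // W' ≠ ⊥ ∧ W' < W ∧ Stabilizes X W'} ≃o
      {U : Submodule F W // U ≠ ⊥ ∧ U ≠ ⊤ ∧ Stabilizes h.restrict U} where
  toFun x := ⟨x.1.comap W.subtype, by
    obtain ⟨W', h1, h2, h3⟩ := x
    have hmap : (W'.comap W.subtype).map W.subtype = W' := by
      rw [Submodule.map_comap_subtype, inf_eq_right.2 h2.le]
    refine ⟨fun h0 => h1 ?_, fun h0 => h2.ne ?_, stabilizes_of_le fun a w hw => h3.apply_mem a hw⟩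
    · rw [← hmap, h0, Submodule.map_bot]
    · rw [← hmap, h0, Submodule.map_subtype_top]⟩
  invFun x := ⟨x.1.map W.subtype, by
    obtain ⟨U, h1, h2, h3⟩ := x
    refine ⟨fun h0 => h1 ?_, lt_of_le_of_ne (Submodule.map_subtype_le W U) fun h0 => h2 ?_,
      stabilizes_of_le fun a => ?_⟩
    · exact Submodule.map_injective_of_injective W.injective_subtype
        (h0.trans (Submodule.map_bot _).symm)
    · apply Submodule.map_injective_of_injective W.injective_subtype
      rw [h0, Submodule.map_subtype_top]
    · rintro _ ⟨w, hw, rfl⟩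
      exact ⟨h.restrict a w, h3.apply_mem a hw, rfl⟩⟩
  left_inv x := Subtype.ext <| by
    change (x.1.comap W.subtype).map W.subtype = x.1
    rw [Submodule.map_comap_subtype, inf_eq_right.2 x.2.2.1.le]
  right_inv x := Subtype.ext (Submodule.comap_map_eq_of_injective W.injective_subtype x.1)
  map_rel_iff' := by
    rintro ⟨U, h1, h2, h3⟩ ⟨U', h1', h2', h3'⟩
    change U.comap W.subtype ≤ U'.comap W.subtype ↔ U ≤ U'
    exact ⟨fun hle x hx => hle (x := ⟨x, h2.le hx⟩) hx, fun hle => Submodule.comap_mono hle⟩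

theorem equivariantChar_restrict [FiniteDimensional F V] {X : A →* (V ≃ₗ[F] V)}
    {W : Submodule F V} (h : Stabilizes X W) (hW : W ≠ ⊥) : equivariantChar h.restrict =
      reducedEulerChar {W' : Submodule F V // W' ≠ ⊥ ∧ W' < W ∧ Stabilizes X W'} := by
  rw [equivariantChar, if_neg, reducedEulerChar_congr h.orderIso]
  rwa [Submodule.finrank_eq_zero]

/-- With `S` the poset of nonzero proper invariant subspaces, the zero space contributes `1`, the
whole space `χ̃(S)` and `W` in `S` contributes `χ̃(S_{<W})`. The total vanishes by
`reducedEulerChar_eq_sum`. -/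
theorem sum_equivariantChar_restrict [Finite V] (X : A →* (V ≃ₗ[F] V))
    (hV : Module.finrank F V ≠ 0) :
    ∑ᶠ W : {W : Submodule F V // Stabilizes X W}, equivariantChar W.2.restrict = 0 := by
  classical
  let S := {W : Submodule F V // W ≠ ⊥ ∧ W ≠ ⊤ ∧ Stabilizes X W}
  have hbt : (⊥ : Submodule F V) ≠ ⊤ := by
    intro h
    apply hV
    rw [← finrank_top, ← h, finrank_bot]
  let Φ : Option (Option S) → {W : Submodule F V // Stabilizes X W} := fun o =>
    o.elim ⟨⊥, stabilizes_bot X⟩ fun o => o.elim ⟨⊤, stabilizes_top X⟩ fun W => ⟨W.1, W.2.2.2⟩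
  have hΦ : Function.Bijective Φ := by
    constructor
    · rintro (_ | _ | ⟨W, h1, h2, h3⟩) (_ | _ | ⟨W', h1', h2', h3'⟩) h
      all_goals have h := congrArg Subtype.val h
      · rfl
      · exact absurd h hbt
      · exact absurd h.symm h1'
      · exact absurd h.symm hbt
      · rfl
      · exact absurd h.symm h2'
      · exact absurd h h1
      · exact absurd h h2
      · obtain rfl : W = W' := h
        rfl
    · rintro ⟨W, hW⟩
      by_cases h1 : W = ⊥
      · subst h1; exact ⟨none, rfl⟩
      by_cases h2 : W = ⊤
      · subst h2; exact ⟨some none, rfl⟩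
      exact ⟨some (some ⟨W, h1, h2, hW⟩), rfl⟩
  let _ := Fintype.ofFinite S
  rw [← finsum_eq_of_bijective Φ hΦ (fun _ => rfl), finsum_eq_sum_of_fintype, Fintype.sum_option,
    Fintype.sum_option]
  have h1 : equivariantChar (Φ none).2.restrict = 1 := by
    rw [equivariantChar, if_pos]
    exact finrank_bot F V
  have h2 : equivariantChar (Φ (some none)).2.restrict = reducedEulerChar S := by
    refine (equivariantChar_restrict (stabilizes_top X) hbt.symm).trans ?_
    exact reducedEulerChar_congr
      ⟨Equiv.subtypeEquivRight fun W => by rw [lt_top_iff_ne_top], Iff.rfl⟩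
  have h3 : ∀ W : S, equivariantChar (Φ (some (some W))).2.restrict =
      reducedEulerChar {x : S // x < W} := by
    intro W
    refine (equivariantChar_restrict W.2.2.2 W.2.1).trans ?_
    refine reducedEulerChar_congr ⟨⟨fun x => ⟨⟨x.1, x.2.1, (x.2.2.1.trans_le le_top).ne, x.2.2.2⟩,
      x.2.2.1⟩, fun x => ⟨x.1.1, x.1.2.1, x.2, x.1.2.2.2⟩, fun _ => rfl, fun _ => rfl⟩, Iff.rfl⟩
  rw [h1, h2, Finset.sum_congr rfl fun W _ => h3 W, reducedEulerChar_eq_sum S]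
  ring

variable (A F V) in
/-- The sum of the reduced Euler characteristics of all representations on a vector space. -/
def charSum : ℤ := ∑ᶠ X : A →* (V ≃ₗ[F] V), equivariantChar X

/-- The isomorphism of general linear groups induced by an isomorphism. -/
def linearEquivConj (e : V ≃ₗ[F] V') : (V ≃ₗ[F] V) ≃* (V' ≃ₗ[F] V') where
  toFun g := e.symm ≪≫ₗ g ≪≫ₗ e
  invFun g := e ≪≫ₗ g ≪≫ₗ e.symm
  left_inv g := by ext; simp
  right_inv g := by ext; simp
  map_mul' g h := by ext; simp

@[simp] theorem linearEquivConj_apply (e : V ≃ₗ[F] V') (g : V ≃ₗ[F] V) (v : V') :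
    linearEquivConj e g v = e (g (e.symm v)) := rfl

theorem MonoidHom.comp_mulEquiv_bijective {G H : Type*} [Group G] [Group H] (φ : G ≃* H) :
    Function.Bijective fun X : A →* G => φ.toMonoidHom.comp X :=
  ⟨fun _ _ h => MonoidHom.ext fun a => φ.injective (DFunLike.congr_fun h a), fun Y =>
    ⟨φ.symm.toMonoidHom.comp Y, MonoidHom.ext fun a => φ.apply_symm_apply (Y a)⟩⟩

theorem charSum_congr [FiniteDimensional F V] [FiniteDimensional F V'] (e : V ≃ₗ[F] V') :
    charSum A F V = charSum A F V' :=
  finsum_eq_of_bijective _ (MonoidHom.comp_mulEquiv_bijective (linearEquivConj e)) fun X =>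
    equivariantChar_congr e fun a v => by simp

theorem card_hom_congr (A : Type*) [Group A] {G H : Type*} [Group G] [Group H] (φ : G ≃* H) :
    Nat.card (A →* G) = Nat.card (A →* H) :=
  Nat.card_eq_of_bijective _ (MonoidHom.comp_mulEquiv_bijective φ)

end EquivariantChar

/-! ### The convolution identity between Euler characteristics and representation counts -/

noncomputable section Recursion

variable (p : ℕ) [hp : Fact p.Prime] (r : ℕ) (F : Type*) [Field F]

attribute [local instance] finite_primaryHom

/-- The groupoid cardinality of the representations of `ℤ × ℤ_p ^ (r - 1)` on a vector space. -/
def homWeight (V : Type*) [AddCommGroup V] [Module F V] : ℚ :=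
  Nat.card (PrimaryHom p r (V ≃ₗ[F] V)) / Nat.card (V ≃ₗ[F] V)

/-- The equivariant Euler characteristic of the invariant subspaces of a vector space. -/
def charWeight (V : Type*) [AddCommGroup V] [Module F V] : ℚ :=
  charSum (Multiplicative (ℤ × (Fin (r - 1) → ℤ_[p]))) F V / Nat.card (V ≃ₗ[F] V)

variable {F} {V : Type*} [AddCommGroup V] [Module F V]

theorem homWeight_congr {V' : Type*} [AddCommGroup V'] [Module F V'] (e : V ≃ₗ[F] V') :
    homWeight p r F V = homWeight p r F V' := by
  rw [homWeight, homWeight, PrimaryHom, PrimaryHom, card_hom_congr _ (linearEquivConj e),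
    Nat.card_congr (linearEquivConj e).toEquiv]

theorem charWeight_congr {V' : Type*} [AddCommGroup V'] [Module F V'] [FiniteDimensional F V]
    [FiniteDimensional F V'] (e : V ≃ₗ[F] V') : charWeight p r F V = charWeight p r F V' := by
  rw [charWeight, charWeight, charSum_congr e, Nat.card_congr (linearEquivConj e).toEquiv]

theorem sum_comp_eq_card_ker_mul {P Q : Type*} [Group P] [Group Q] [Finite P] [Finite Q]
    {π : P →* Q} (hπ : Function.Surjective π) (hU : p.Coprime (Nat.card π.ker))
    (f : PrimaryHom p r Q → ℤ) :
    ∑ᶠ X : PrimaryHom p r P, f (π.comp X) = Nat.card π.ker * ∑ᶠ Y : PrimaryHom p r Q, f Y := by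
  classical
  let _ := Fintype.ofFinite (PrimaryHom p r P)
  let _ := Fintype.ofFinite (PrimaryHom p r Q)
  let Ψ : PrimaryHom p r P → PrimaryHom p r Q := fun X => π.comp X
  rw [finsum_eq_sum_of_fintype, finsum_eq_sum_of_fintype,
    ← (Equiv.sigmaFiberEquiv Ψ).sum_comp, Fintype.sum_sigma, Finset.mul_sum]
  refine Finset.sum_congr rfl fun Y _ => ?_
  have h1 : ∀ X : {X // Ψ X = Y}, f (π.comp (Equiv.sigmaFiberEquiv Ψ ⟨Y, X⟩)) = f Y := fun X =>
    congrArg f X.2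
  rw [Finset.sum_congr rfl fun X _ => h1 X, Finset.sum_const, Finset.card_univ,
    ← Nat.card_eq_fintype_card, nsmul_eq_mul]
  congr 2
  exact card_primaryHom_lifts hπ hU Y

theorem sum_sum_subtype_comm {ι κ : Type*} [Fintype ι] [Fintype κ] {R : ι → κ → Prop}
    (f : ∀ i k, R i k → ℤ) : ∑ i, ∑ᶠ k : {k // R i k}, f i k k.2 =
      ∑ k, ∑ᶠ i : {i // R i k}, f i k i.2 := by
  classical
  simp only [finsum_eq_sum_of_fintype]
  rw [← Fintype.sum_sigma (f := fun x : Σ i, {k // R i k} => f x.1 x.2 x.2.2),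
    ← Fintype.sum_sigma (f := fun x : Σ k, {i // R i k} => f x.2 x.1 x.2.2)]
  exact Fintype.sum_equiv ⟨fun x => ⟨x.2.1, x.1, x.2.2⟩, fun x => ⟨x.2.1, x.1, x.2.2⟩,
    fun _ => rfl, fun _ => rfl⟩ _ _ fun _ => rfl

theorem sum_comp_fst {A G H : Type*} [Group A] [Group G] [Group H] [Finite (A →* G)]
    [Finite (A →* H)] (f : (A →* G) → ℤ) :
    ∑ᶠ Y : A →* G × H, f ((MonoidHom.fst G H).comp Y) =
      (∑ᶠ Y : A →* G, f Y) * Nat.card (A →* H) := by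
  let _ := Fintype.ofFinite (A →* G)
  let _ := Fintype.ofFinite (A →* H)
  have hbij : Function.Bijective fun Y : (A →* G) × (A →* H) => Y.1.prod Y.2 :=
    ⟨fun Y Y' h => Prod.ext
      (by simpa using congrArg (fun Z => (MonoidHom.fst G H).comp Z) h)
      (by simpa using congrArg (fun Z => (MonoidHom.snd G H).comp Z) h),
      fun Z => ⟨((MonoidHom.fst G H).comp Z, (MonoidHom.snd G H).comp Z), rfl⟩⟩
  rw [← finsum_eq_of_bijective (f := fun Y : (A →* G) × (A →* H) => f Y.1) _ hbij fun Y => rfl,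
    finsum_eq_sum_of_fintype, Fintype.sum_prod_type, finsum_eq_sum_of_fintype, Finset.sum_mul]
  refine Finset.sum_congr rfl fun Y _ => ?_
  change ∑ _Z : A →* H, f Y = _
  rw [Finset.sum_const, Finset.card_univ, ← Nat.card_eq_fintype_card, nsmul_eq_mul, mul_comm]

/-- The representations preserving `W` are the homomorphisms to its parabolic subgroup. Their
restriction to `W` depends only on the Levi part, whose fibres all have the order of the unipotent
radical, and the Levi quotient is a product. -/
theorem sum_equivariantChar_stabilizes [Finite V] {l : ℕ} (hl : l.Prime) (hpl : p ≠ l) [CharP F l]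
    (W : Submodule F V) :
    ∑ᶠ X : {X : PrimaryHom p r (V ≃ₗ[F] V) // Stabilizes X W}, equivariantChar X.2.restrict =
      Nat.card (parabolicToLevi W).ker *
        (charSum (Multiplicative (ℤ × (Fin (r - 1) → ℤ_[p]))) F W *
          Nat.card (PrimaryHom p r ((V ⧸ W) ≃ₗ[F] (V ⧸ W)))) := by
  have : Finite (V ⧸ W) := Finite.of_surjective _ (Submodule.Quotient.mk_surjective W)
  rw [charSum, ← sum_comp_fst (A := Multiplicative (ℤ × (Fin (r - 1) → ℤ_[p])))
    (H := (V ⧸ W) ≃ₗ[F] (V ⧸ W)) equivariantChar,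
    ← sum_comp_eq_card_ker_mul p r (parabolicToLevi_surjective W)
      (coprime_card_ker_parabolicToLevi hp.out hl hpl W)]
  refine finsum_eq_of_bijective (fun X => X.1.codRestrict (parabolic W) X.2) ⟨fun X Y h => ?_,
    fun Z => ⟨⟨(parabolic W).subtype.comp Z, fun a => (Z a).2⟩, rfl⟩⟩ fun X => rfl
  exact Subtype.ext (congrArg (fun Z => (parabolic W).subtype.comp Z) h)

/-- Double counting of pairs of a representation and an invariant subspace. The factor `|parabolic
W|` absorbs the radical and the two denominators in the weights. -/
theorem sum_charWeight_mul_homWeight_submodule [Finite V] {l : ℕ} (hl : l.Prime) (hpl : p ≠ l)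
    [CharP F l] (hV : Module.finrank F V ≠ 0) :
    ∑ᶠ W : Submodule F V, (Nat.card (parabolic W) : ℚ) *
      (charWeight p r F W * homWeight p r F (V ⧸ W)) = 0 := by
  classical
  let _ := Fintype.ofFinite (PrimaryHom p r (V ≃ₗ[F] V))
  let _ := Fintype.ofFinite (Submodule F V)
  have h1 : ∑ X : PrimaryHom p r (V ≃ₗ[F] V), ∑ᶠ W : {W : Submodule F V // Stabilizes X W},
      equivariantChar W.2.restrict = 0 :=
    Finset.sum_eq_zero fun X _ => sum_equivariantChar_restrict X hV
  have h2 : ∑ W : Submodule F V, ∑ᶠ X : {X : PrimaryHom p r (V ≃ₗ[F] V) // Stabilizes X W},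
      equivariantChar X.2.restrict = 0 := by
    rw [← h1]
    exact (sum_sum_subtype_comm fun X W h => equivariantChar (Stabilizes.restrict h)).symm
  rw [finsum_eq_sum_of_fintype]
  have h3 := congrArg (Int.cast (R := ℚ)) h2
  rw [Int.cast_zero, Int.cast_sum] at h3
  rw [← h3]
  refine Finset.sum_congr rfl fun W _ => ?_
  have : Finite (V ⧸ W) := Finite.of_surjective _ (Submodule.Quotient.mk_surjective W)
  have hpos : ∀ (U : Type _) [AddCommGroup U] [Module F U] [Finite U],
      (Nat.card (U ≃ₗ[F] U) : ℚ) ≠ 0 := fun U => by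
    intros
    exact_mod_cast Nat.card_pos.ne'
  rw [sum_equivariantChar_stabilizes p r hl hpl, card_parabolic, charWeight, homWeight]
  have a1 := hpos W
  have a2 := hpos (V ⧸ W)
  push_cast
  field_simp

variable (F) in
-- The weights depend only on dimensions, and the subspaces of dimension `k`, each weighted by the
-- order of its parabolic subgroup, add up to the order of the whole group for every `k`. That
-- common factor cancels.
theorem sum_charWeight_mul_homWeight [Finite F] {l : ℕ} (hl : l.Prime) (hpl : p ≠ l)
    [CharP F l] {n : ℕ} (hn : n ≠ 0) :
    ∑ k ∈ Finset.range (n + 1), charWeight p r F (Fin k → F) * homWeight p r F (Fin (n - k) → F)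
      = 0 := by
  classical
  let V := Fin n → F
  have hV : Module.finrank F V = n := by simp [V]
  let _ := Fintype.ofFinite (Submodule F V)
  have h1 := sum_charWeight_mul_homWeight_submodule (V := V) p r hl hpl (by rw [hV]; exact hn)
  rw [finsum_eq_sum_of_fintype, ← Finset.sum_fiberwise_of_maps_to
    (g := fun W : Submodule F V => Module.finrank F W) (t := Finset.range (n + 1)) (by
      intro W _
      have := Submodule.finrank_le W
      rw [Finset.mem_range]
      omega)] at h1
  have hG : (Nat.card (V ≃ₗ[F] V) : ℚ) ≠ 0 := by exact_mod_cast Nat.card_pos.ne'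
  apply mul_left_cancel₀ hG
  rw [mul_zero, ← h1, Finset.mul_sum]
  refine Finset.sum_congr rfl fun k hk => ?_
  obtain ⟨W₀, hW₀⟩ := exists_submodule_finrank_eq (F := F) (V := V) (k := k)
    (by rw [hV]; exact Nat.lt_succ_iff.1 (Finset.mem_range.1 hk))
  have hcard : ∀ W : Submodule F V, Module.finrank F W = k →
      ((Finset.univ.filter fun W : Submodule F V => Module.finrank F W = k).card : ℚ) *
        Nat.card (parabolic W) = Nat.card (V ≃ₗ[F] V) := by
    intro W hW
    have := card_finrank_eq_mul_card_parabolic W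
    rw [hW, Nat.card_eq_fintype_card, Fintype.card_subtype] at this
    exact_mod_cast this
  have hconst : ∀ W ∈ Finset.univ.filter fun W : Submodule F V => Module.finrank F W = k,
      (Nat.card (parabolic W) : ℚ) * (charWeight p r F W * homWeight p r F (V ⧸ W)) =
      (Nat.card (parabolic W₀) : ℚ) *
        (charWeight p r F (Fin k → F) * homWeight p r F (Fin (n - k) → F)) := by
    intro W hW
    have hW' := (Finset.mem_filter.1 hW).2
    obtain ⟨a⟩ := FiniteDimensional.nonempty_linearEquiv_of_finrank_eq
      (show Module.finrank F W = Module.finrank F (Fin k → F) by rw [hW']; simp)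
    obtain ⟨b⟩ := FiniteDimensional.nonempty_linearEquiv_of_finrank_eq
      (show Module.finrank F (V ⧸ W) = Module.finrank F (Fin (n - k) → F) by
        have := Submodule.finrank_quotient_add_finrank W
        rw [Module.finrank_fin_fun]
        omega)
    rw [charWeight_congr p r a, homWeight_congr p r b]
    congr 1
    have h0 : ((Finset.univ.filter fun W : Submodule F V =>
        Module.finrank F W = k).card : ℚ) ≠ 0 := by
      exact_mod_cast (Finset.card_pos.2 ⟨W, hW⟩).ne'
    exact mul_left_cancel₀ h0 ((hcard W hW').trans (hcard W₀ hW₀).symm)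
  rw [Finset.sum_congr rfl hconst, Finset.sum_const, nsmul_eq_mul, ← hcard W₀ hW₀]
  ring

end Recursion

/-! ### Finite modules over finite commutative semisimple rings -/

noncomputable section IsotypicRank

open Submodule

variable {R : Type*} [CommRing R] (M : Type*) [AddCommGroup M] [Module R M]
  {M' : Type*} [AddCommGroup M'] [Module R M']

/-- The multiplicity of the simple module `R ⧸ I` in a semisimple module. -/
def isotypicRank (I : MaximalSpectrum R) : ℕ :=
  Module.finrank (R ⧸ I.asIdeal) (torsionBySet R M (I.asIdeal : Set R))

theorem MaximalSpectrum.sup_eq_top {I J : MaximalSpectrum R} (h : I ≠ J) :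
    I.asIdeal ⊔ J.asIdeal = ⊤ :=
  I.isMaximal.coprime_of_ne J.isMaximal fun h' => h (MaximalSpectrum.ext h')

theorem iInf_maximalSpectrum_eq_bot [IsSemisimpleRing R] :
    ⨅ I : MaximalSpectrum R, I.asIdeal = ⊥ := by
  rw [eq_bot_iff, ← IsSemisimpleRing.jacobson_eq_bot R]
  refine le_sInf fun m hm => ?_
  exact iInf_le (fun I : MaximalSpectrum R => I.asIdeal) ⟨m, ⟨hm⟩⟩

variable {M} in
theorem isotypicRank_congr (e : M ≃ₗ[R] M') (I : MaximalSpectrum R) :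
    isotypicRank M I = isotypicRank M' I := by
  have h : (torsionBySet R M (I.asIdeal : Set R)).map (e : M →ₗ[R] M') =
      torsionBySet R M' (I.asIdeal : Set R) := by
    ext x
    constructor
    · rintro ⟨y, hy, rfl⟩
      rw [mem_torsionBySet_iff]
      intro a
      have := (mem_torsionBySet_iff _ _).1 hy a
      rw [LinearEquiv.coe_coe, ← map_smul, this, map_zero]
    · intro hx
      refine ⟨e.symm x, ?_, e.apply_symm_apply x⟩
      rw [SetLike.mem_coe, mem_torsionBySet_iff]
      intro a
      have := (mem_torsionBySet_iff _ _).1 hx a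
      rw [← map_smul, this, map_zero]
  exact ((e.ofSubmodules _ _ h).extendScalarsOfSurjective
    (S := R ⧸ I.asIdeal) Ideal.Quotient.mk_surjective).finrank_eq

/-- The decomposition of a module over a semisimple ring into isotypic components. -/
def isotypicDecomposition [Finite R] [IsSemisimpleRing R] :
    M ≃ₗ[R] ((I : MaximalSpectrum R) → torsionBySet R M (I.asIdeal : Set R)) := by
  classical
  let _ := Fintype.ofFinite (MaximalSpectrum R)
  have hp : ((Finset.univ : Finset (MaximalSpectrum R)) : Set (MaximalSpectrum R)).Pairwise
      fun i j => i.asIdeal ⊔ j.asIdeal = ⊤ := fun i _ j _ h => MaximalSpectrum.sup_eq_top h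
  have h1 : iSupIndep fun I : MaximalSpectrum R => torsionBySet R M (I.asIdeal : Set R) :=
    iSupIndep_iff_supIndep_univ.2 (supIndep_torsionBySet_ideal hp)
  have h2 : ⨆ I : MaximalSpectrum R, torsionBySet R M (I.asIdeal : Set R) = ⊤ := by
    have := iSup_torsionBySet_ideal_eq_torsionBySet_iInf (M := M) hp
    simp only [Finset.mem_univ, iSup_pos, iInf_pos, iInf_maximalSpectrum_eq_bot] at this
    rw [this]
    ext x
    simp
  exact (LinearEquiv.ofBijective
    (DirectSum.coeLinearMap fun I : MaximalSpectrum R => torsionBySet R M (I.asIdeal : Set R))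
    (DirectSum.isInternal_submodule_of_iSupIndep_of_iSup_eq_top h1 h2)).symm ≪≫ₗ
    DirectSum.linearEquivFunOnFintype R _ _

theorem nonempty_linearEquiv_of_isotypicRank_eq [Finite R] [IsSemisimpleRing R] [Finite M]
    [Finite M'] (h : ∀ I : MaximalSpectrum R, isotypicRank M I = isotypicRank M' I) :
    Nonempty (M ≃ₗ[R] M') := by
  have key : ∀ I : MaximalSpectrum R, Nonempty (torsionBySet R M (I.asIdeal : Set R) ≃ₗ[R]
      torsionBySet R M' (I.asIdeal : Set R)) := fun I => by
    let _ := Ideal.Quotient.field I.asIdeal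
    obtain ⟨e⟩ := FiniteDimensional.nonempty_linearEquiv_of_finrank_eq (R := R ⧸ I.asIdeal)
      (M := torsionBySet R M (I.asIdeal : Set R)) (M' := torsionBySet R M' (I.asIdeal : Set R))
      (h I)
    exact ⟨e.restrictScalars R⟩
  exact ⟨isotypicDecomposition M ≪≫ₗ
    LinearEquiv.piCongrRight (fun I => (key I).some) ≪≫ₗ (isotypicDecomposition M').symm⟩

theorem card_eq_prod_pow_isotypicRank [Finite R] [IsSemisimpleRing R] [Finite M]
    [Fintype (MaximalSpectrum R)] :
    Nat.card M = ∏ I : MaximalSpectrum R, Nat.card (R ⧸ I.asIdeal) ^ isotypicRank M I := by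
  rw [Nat.card_congr (isotypicDecomposition (R := R) M).toEquiv, Nat.card_pi]
  refine Finset.prod_congr rfl fun I _ => ?_
  let _ := Ideal.Quotient.field I.asIdeal
  exact Module.natCard_eq_pow_finrank (K := R ⧸ I.asIdeal)

/-- The rank of a direct sum of simple modules. -/
theorem isotypicRank_pi (m : MaximalSpectrum R → ℕ) (J : MaximalSpectrum R) :
    isotypicRank ((I : MaximalSpectrum R) → Fin (m I) → R ⧸ I.asIdeal) J = m J := by
  classical
  let N := (I : MaximalSpectrum R) → Fin (m I) → R ⧸ I.asIdeal
  have h0 : ∀ (I : MaximalSpectrum R) (a : R), a ∈ I.asIdeal → ∀ x : Fin (m I) → R ⧸ I.asIdeal,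
      a • x = 0 := fun I a ha x => by
    ext k
    rw [Pi.smul_apply, Algebra.smul_def, Ideal.Quotient.algebraMap_eq,
      Ideal.Quotient.eq_zero_iff_mem.2 ha, zero_mul, Pi.zero_apply]
  let φ : (Fin (m J) → R ⧸ J.asIdeal) →ₗ[R] torsionBySet R N (J.asIdeal : Set R) :=
    (LinearMap.single R (fun I : MaximalSpectrum R => Fin (m I) → R ⧸ I.asIdeal) J).codRestrict _
      fun x => by
        rw [mem_torsionBySet_iff]
        intro a
        rw [← map_smul, h0 J a a.2, map_zero]
  have hφ : Function.Bijective φ := by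
    constructor
    · intro x y h
      exact Pi.single_injective J (congrArg Subtype.val h)
    · rintro ⟨t, ht⟩
      refine ⟨t J, Subtype.ext (funext fun I => ?_)⟩
      change Pi.single (M := fun I : MaximalSpectrum R => Fin (m I) → R ⧸ I.asIdeal) J (t J) I = t I
      by_cases h : I = J
      · subst h
        simp
      · rw [Pi.single_eq_of_ne h]
        -- Write `1 = a + b` with `a ∈ I` and `b ∈ J`: `a` kills the `I`-component and `b` kills the
        -- `J`-torsion element `t`, so `t I = 0`.
        have h1 : (1 : R) ∈ I.asIdeal ⊔ J.asIdeal := by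
          rw [MaximalSpectrum.sup_eq_top h]
          trivial
        obtain ⟨a, ha, b, hb, hab⟩ := Submodule.mem_sup.1 h1
        have h2 := congrFun ((mem_torsionBySet_iff _ _).1 ht ⟨b, hb⟩) I
        rw [← one_smul R (t I), ← hab, add_smul, h0 I a ha, zero_add]
        exact h2.symm
  have h1 := ((LinearEquiv.ofBijective φ hφ).extendScalarsOfSurjective
    (S := R ⧸ J.asIdeal) Ideal.Quotient.mk_surjective).finrank_eq
  rw [isotypicRank, ← h1]
  let _ := Ideal.Quotient.field J.asIdeal
  exact Module.finrank_fin_fun (R ⧸ J.asIdeal)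

end IsotypicRank

/-! ### Conjugacy classes of representations as multiplicity functions -/

noncomputable section OrbitCount

open Submodule

variable {F H V : Type*} [Field F] [CommGroup H] [AddCommGroup V] [Module F V]

/-- The linear representation given by a homomorphism to the general linear group. -/
def toRepresentation (f : H →* (V ≃ₗ[F] V)) : Representation F H V :=
  (LinearEquiv.automorphismGroup.toLinearMapMonoidHom (R := F) (M := V)).comp f

theorem single_smul_asModule (f : H →* (V ≃ₗ[F] V)) (a : H)
    (v : (toRepresentation f).asModule) :
    (MonoidAlgebra.single a (1 : F) • v : (toRepresentation f).asModule) = (f a : V → V) v := by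
  rw [Representation.single_smul, one_smul]
  rfl

/-- An equivariant linear equivalence is an equivalence of modules over the group algebra. -/
def equivOfEquivariant {M N : Type*} [AddCommGroup M] [AddCommGroup N] [Module F M] [Module F N]
    [Module (MonoidAlgebra F H) M] [Module (MonoidAlgebra F H) N]
    [IsScalarTower F (MonoidAlgebra F H) M] [IsScalarTower F (MonoidAlgebra F H) N]
    (e : M ≃ₗ[F] N) (h : ∀ (a : H) (v : M), e (MonoidAlgebra.single a (1 : F) • v) =
      MonoidAlgebra.single a (1 : F) • e v) : M ≃ₗ[MonoidAlgebra F H] N :=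
  LinearEquiv.ofBijective (MonoidAlgebra.equivariantOfLinearOfComm e.toLinearMap h) e.bijective

attribute [local instance] conjHomAction

theorem orbitRel_iff_nonempty_linearEquiv (f f' : H →* (V ≃ₗ[F] V)) :
    MulAction.orbitRel (V ≃ₗ[F] V) (H →* (V ≃ₗ[F] V)) f f' ↔
      Nonempty ((toRepresentation f').asModule ≃ₗ[MonoidAlgebra F H]
        (toRepresentation f).asModule) := by
  rw [MulAction.orbitRel_apply]
  constructor
  · rintro ⟨g, rfl⟩
    refine ⟨equivOfEquivariant
      (show (toRepresentation f').asModule ≃ₗ[F] (toRepresentation (g • f')).asModule from g)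
      fun a v => ?_⟩
    rw [single_smul_asModule, single_smul_asModule, conjHomAction_smul_apply]
    change g (f' a v) = g (f' a (g.symm (g v)))
    exact congrArg (fun w => g (f' a w)) (g.symm_apply_apply v).symm
  · rintro ⟨e⟩
    let g : V ≃ₗ[F] V := (show (toRepresentation f').asModule ≃ₗ[F]
      (toRepresentation f).asModule from e.restrictScalars F)
    refine ⟨g, MonoidHom.ext fun a => LinearEquiv.ext fun v => ?_⟩
    change g (f' a (g.symm v)) = f a v
    obtain ⟨w, rfl⟩ := g.surjective v
    rw [LinearEquiv.symm_apply_apply]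
    have h : ∀ w : (toRepresentation f').asModule, e (f' a w : V) = f a (e w) := fun w => by
      have h := e.map_smul (MonoidAlgebra.single a (1 : F)) w
      rwa [single_smul_asModule, single_smul_asModule] at h
    exact h w

/-- The degrees of the simple modules. -/
abbrev simpleDegree (F R : Type*) [Field F] [CommRing R] [Algebra F R] (I : MaximalSpectrum R) :
    ℕ := Module.finrank F (R ⧸ I.asIdeal)

/-- Comparing cardinalities as powers of `|F|` gives the dimension formula without relating the
actions of `F` and `R` on `M`. -/
theorem sum_isotypicRank_mul_eq_finrank (R M : Type*) [CommRing R] [Algebra F R] [AddCommGroup M]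
    [Module R M] [Module F M] [Finite F] [Finite R]
    [IsSemisimpleRing R] [Finite M] [Fintype (MaximalSpectrum R)] :
    ∑ I : MaximalSpectrum R, isotypicRank M I * simpleDegree F R I = Module.finrank F M := by
  have h1 := card_eq_prod_pow_isotypicRank (R := R) M
  have h2 : ∀ I : MaximalSpectrum R, Nat.card (R ⧸ I.asIdeal) = Nat.card F ^ simpleDegree F R I :=
    fun I => Module.natCard_eq_pow_finrank
  rw [Module.natCard_eq_pow_finrank (K := F)] at h1
  simp only [h2, ← pow_mul, Finset.prod_pow_eq_pow_sum] at h1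
  have h3 := Nat.pow_right_injective (Finite.one_lt_card (α := F)) h1
  rw [h3]
  exact Finset.sum_congr rfl fun I _ => mul_comm _ _

theorem exists_hom_linearEquiv {N : Type*} [AddCommGroup N] [Module F N]
    [Module (MonoidAlgebra F H) N] [IsScalarTower F (MonoidAlgebra F H) N] (e : N ≃ₗ[F] V) :
    ∃ f : H →* (V ≃ₗ[F] V),
      Nonempty (N ≃ₗ[MonoidAlgebra F H] (toRepresentation f).asModule) := by
  let f₀ : H →* (N ≃ₗ[F] N) :=
    (LinearMap.GeneralLinearGroup.generalLinearEquiv F N).toMonoidHom.comp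
      (Representation.ofModule' (k := F) (G := H) N).toHomUnits
  have hf₀ : ∀ a v, f₀ a v = MonoidAlgebra.single a (1 : F) • v := fun a v => rfl
  let f : H →* (V ≃ₗ[F] V) := (linearEquivConj e).toMonoidHom.comp f₀
  refine ⟨f, ⟨equivOfEquivariant
    (show N ≃ₗ[F] (toRepresentation f).asModule from e) fun a v => ?_⟩⟩
  rw [single_smul_asModule]
  change _ = e (f₀ a (e.symm (e v)))
  rw [LinearEquiv.symm_apply_apply, hf₀]
  rfl

/-- By Maschke's theorem the group algebra is semisimple, so multiplicities classify
representations. Every multiplicity function of total degree `dim V` is realized by transporting a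
direct sum of simple modules to `V`. -/
theorem card_orbits_eq [Finite F] [Finite V] [Finite H] [NeZero (Nat.card H : F)]
    [Fintype (MaximalSpectrum (MonoidAlgebra F H))] :
    Nat.card (Quotient (MulAction.orbitRel (V ≃ₗ[F] V) (H →* (V ≃ₗ[F] V)))) =
      Nat.card {m : MaximalSpectrum (MonoidAlgebra F H) → ℕ //
        ∑ I, m I * simpleDegree F (MonoidAlgebra F H) I = Module.finrank F V} := by
  have hR : Finite (MonoidAlgebra F H) := Module.finite_of_finite F
  have hss : IsSemisimpleRing (MonoidAlgebra F H) := inferInstance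
  have hM : ∀ f : H →* (V ≃ₗ[F] V), Finite (toRepresentation f).asModule := fun f =>
    inferInstanceAs (Finite V)
  refine Nat.card_eq_of_bijective (Quotient.lift (fun f : H →* (V ≃ₗ[F] V) =>
    ⟨fun I => isotypicRank (toRepresentation f).asModule I,
      sum_isotypicRank_mul_eq_finrank (F := F) (MonoidAlgebra F H)
        (toRepresentation f).asModule⟩) ?_) ⟨?_, ?_⟩
  · intro f f' h
    obtain ⟨e⟩ := (orbitRel_iff_nonempty_linearEquiv f f').1 h
    exact Subtype.ext (funext fun I => isotypicRank_congr e.symm I)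
  · intro x y
    induction x using Quotient.inductionOn
    induction y using Quotient.inductionOn
    intro h
    apply Quotient.sound
    refine (orbitRel_iff_nonempty_linearEquiv _ _).2 ?_
    exact nonempty_linearEquiv_of_isotypicRank_eq (R := MonoidAlgebra F H) _
      fun I => (congrFun (congrArg Subtype.val h) I).symm
  · rintro ⟨m, hm⟩
    let N := (I : MaximalSpectrum (MonoidAlgebra F H)) →
      Fin (m I) → MonoidAlgebra F H ⧸ I.asIdeal
    have hI : ∀ I : MaximalSpectrum (MonoidAlgebra F H), Finite (MonoidAlgebra F H ⧸ I.asIdeal) :=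
      fun I => Finite.of_surjective _ Ideal.Quotient.mk_surjective
    have hN : Finite N := Pi.finite
    have h1 := sum_isotypicRank_mul_eq_finrank (F := F) (MonoidAlgebra F H) N
    simp only [N, isotypicRank_pi] at h1
    obtain ⟨e⟩ := FiniteDimensional.nonempty_linearEquiv_of_finrank_eq (R := F)
      (h1.symm.trans hm : Module.finrank F N = Module.finrank F V)
    obtain ⟨f, ⟨e'⟩⟩ := exists_hom_linearEquiv (H := H) e
    refine ⟨Quotient.mk _ f, Subtype.ext (funext fun I => ?_)⟩
    change isotypicRank (toRepresentation f).asModule I = m I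
    rw [← isotypicRank_congr e' I, isotypicRank_pi]

end OrbitCount

/-! ### Generating functions of weighted multiplicity functions -/

noncomputable section WeightedCount

open PowerSeries

theorem one_sub_X_pow_inv {d : ℕ} (hd : 0 < d) : (1 - X ^ d : PowerSeries ℚ)⁻¹ =
    PowerSeries.mk fun n => if d ∣ n then 1 else 0 := by
  rw [PowerSeries.inv_eq_iff_mul_eq_one (by simp [hd.ne'])]
  ext n
  rw [mul_sub, mul_one, map_sub, coeff_mul_X_pow', coeff_mk, coeff_one]
  by_cases h : d ≤ n
  · obtain ⟨i, rfl⟩ := Nat.exists_eq_add_of_le h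
    simp [hd.ne']
  · rw [if_neg h, sub_zero]
    have : d ∣ n ↔ n = 0 := ⟨fun h' => by
      by_contra h0
      exact h (Nat.le_of_dvd (Nat.pos_of_ne_zero h0) h'), fun h' => h' ▸ dvd_zero d⟩
    simp only [this]

theorem coeff_prod_one_sub_X_pow_inv {ι : Type*} [Fintype ι] {d : ι → ℕ} (hd : ∀ i, 0 < d i)
    (n : ℕ) : coeff n (∏ i, (1 - X ^ d i : PowerSeries ℚ)⁻¹) =
      Nat.card {m : ι → ℕ // ∑ i, m i * d i = n} := by
  classical
  have h1 : coeff n (∏ i, (1 - X ^ d i : PowerSeries ℚ)⁻¹) =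
      ((Finset.univ.finsuppAntidiag n).filter fun l : ι →₀ ℕ => ∀ i, d i ∣ l i).card := by
    rw [coeff_prod, Finset.card_filter, Nat.cast_sum]
    refine Finset.sum_congr rfl fun l _ => ?_
    simp [one_sub_X_pow_inv (hd _), Finset.prod_boole]
  rw [h1, ← Nat.card_eq_finsetCard]
  congr 1
  refine Nat.card_congr
    { toFun := fun l => ⟨fun i => l.1 i / d i, ?_⟩
      invFun := fun m => ⟨Finsupp.equivFunOnFinite.symm fun i => m.1 i * d i, ?_⟩
      left_inv := ?_
      right_inv := ?_ }
  · obtain ⟨l, hl⟩ := l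
    simp only [Finset.mem_filter, Finset.mem_finsuppAntidiag] at hl
    exact (Finset.sum_congr rfl fun i _ => Nat.div_mul_cancel (hl.2 i)).trans hl.1.1
  · simp [Finset.mem_finsuppAntidiag, m.2]
  · rintro ⟨l, hl⟩
    simp only [Finset.mem_filter] at hl
    ext i
    exact Nat.div_mul_cancel (hl.2 i)
  · rintro ⟨m, hm⟩
    ext i
    exact Nat.mul_div_cancel _ (hd i)

theorem X_mul_derivative_weightedCount {ι : Type*} [Fintype ι] {d : ι → ℕ} (hd : ∀ i, 0 < d i) :
    X * d⁄dX ℚ (PowerSeries.mk fun n => (Nat.card {m : ι → ℕ // ∑ i, m i * d i = n} : ℚ)) =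
      (PowerSeries.mk fun k => if k = 0 then 0 else
        ((∑ i, if d i ∣ k then d i else 0 : ℕ) : ℚ)) *
      PowerSeries.mk fun n => (Nat.card {m : ι → ℕ // ∑ i, m i * d i = n} : ℚ) := by
  have h1 : (PowerSeries.mk fun n => (Nat.card {m : ι → ℕ // ∑ i, m i * d i = n} : ℚ)) =
      ∏ i, (1 - X ^ d i : PowerSeries ℚ)⁻¹ := by
    ext n
    rw [coeff_mk, coeff_prod_one_sub_X_pow_inv hd]
  rw [h1, X_mul_derivative_prod _ fun i => X_mul_derivative_inv
    (constantCoeff_one_sub_X_pow (hd i).ne') (X_mul_derivative_one_sub_X_pow (hd i))]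
  congr 1
  ext k
  rw [map_sum, coeff_mk]
  simp only [map_neg, coeff_mk]
  split_ifs with h
  · simp [h]
  · push_cast
    refine Finset.sum_congr rfl fun i _ => ?_
    by_cases h' : d i ∣ k <;> simp [h, h']

end WeightedCount

/-! ### Counting algebra homomorphisms to finite fields -/

noncomputable section AlgHomCount

/-- An algebra map to `E` is a maximal ideal `I`, its kernel, with an embedding of `R ⧸ I` into `E`.
For a residue field of degree `d` there are `d` embeddings if `d` divides the degree of `E`, and
none otherwise. -/
theorem sum_simpleDegree_eq_card_algHom {F R E : Type*} [Field F] [Finite F] [CommRing R]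
    [Finite R] [Algebra F R] [Field E] [Finite E] [Algebra F E] [Fintype (MaximalSpectrum R)] :
    (∑ I : MaximalSpectrum R,
      if simpleDegree F R I ∣ Module.finrank F E then simpleDegree F R I else 0) =
      Nat.card (R →ₐ[F] E) := by
  classical
  have hfin : ∀ I : MaximalSpectrum R, Finite ((R ⧸ I.asIdeal) →ₐ[F] E) := fun I => by
    have : Finite (R ⧸ I.asIdeal) := Finite.of_surjective _ Ideal.Quotient.mk_surjective
    exact Finite.of_injective (fun f => (f : R ⧸ I.asIdeal → E)) DFunLike.coe_injective
  let Φ : (Σ I : MaximalSpectrum R, (R ⧸ I.asIdeal) →ₐ[F] E) → (R →ₐ[F] E) := fun x =>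
    x.2.comp (Ideal.Quotient.mkₐ F x.1.asIdeal)
  have hker : ∀ x, RingHom.ker (Φ x) = x.1.asIdeal := by
    rintro ⟨I, ψ⟩
    let _ := Ideal.Quotient.field I.asIdeal
    ext a
    rw [RingHom.mem_ker]
    change ψ (Ideal.Quotient.mk I.asIdeal a) = 0 ↔ _
    rw [map_eq_zero, Ideal.Quotient.eq_zero_iff_mem]
  have hΦ : Function.Bijective Φ := by
    constructor
    · rintro ⟨I, ψ⟩ ⟨J, χ⟩ h
      obtain rfl : I = J := MaximalSpectrum.ext (by rw [← hker ⟨I, ψ⟩, h, hker])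
      congr 1
      refine AlgHom.ext fun a => ?_
      obtain ⟨a, rfl⟩ := Ideal.Quotient.mk_surjective a
      exact DFunLike.congr_fun h a
    · intro φ
      have := RingHom.ker_isPrime φ
      refine ⟨⟨⟨RingHom.ker φ, IsArtinianRing.isMaximal_of_isPrime _⟩,
        Ideal.Quotient.liftₐ _ φ fun a ha => ha⟩, ?_⟩
      ext a
      rfl
  rw [← Nat.card_eq_of_bijective Φ hΦ, Nat.card_sigma]
  refine Finset.sum_congr rfl fun I _ => ?_
  let _ := Ideal.Quotient.field I.asIdeal
  split_ifs with h
  · exact (FiniteField.natCard_algHom_of_finrank_dvd (K := R ⧸ I.asIdeal) (L := E) h).symm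
  · symm
    rw [Nat.card_eq_zero]
    left
    by_contra hne
    rw [not_isEmpty_iff] at hne
    exact h ((FiniteField.nonempty_algHom_iff_finrank_dvd (K := R ⧸ I.asIdeal)).1 hne)

/-- The unit group is cyclic, so its `p ^ N`-torsion has order `gcd(|E| - 1, p ^ N)`, the full
`p`-part. The count follows by computing the homomorphisms from `ℤ × ℤ_p ^ s` to `Eˣ` in two ways
and cancelling `|Eˣ|`. -/
theorem card_hom_unit_eq {p : ℕ} [hp : Fact p.Prime] {E : Type*} [Field E] [Finite E] (s : ℕ)
    {N : ℕ} (hN : padicValNat p (Nat.card E - 1) ≤ N) :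
    Nat.card (Multiplicative (Fin s → ZMod (p ^ N)) →* Eˣ) = pPart p (Nat.card E - 1) ^ s := by
  have hunits : Nat.card Eˣ = Nat.card E - 1 := Nat.card_units E
  have hpos : 0 < Nat.card Eˣ := Nat.card_pos
  have hgcd : ∀ M, padicValNat p (Nat.card E - 1) ≤ M →
      (Nat.card Eˣ).gcd (p ^ M) = pPart p (Nat.card E - 1) := by
    intro M hM
    rw [hunits] at hpos ⊢
    obtain ⟨c, hc⟩ := pow_padicValNat_dvd (p := p) (n := Nat.card E - 1)
    apply Nat.dvd_antisymm
    · obtain ⟨j, hj, h⟩ := (Nat.dvd_prime_pow hp.out).1 (Nat.gcd_dvd_right (Nat.card E - 1) (p ^ M))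
      rw [h, pPart]
      refine pow_dvd_pow p ((padicValNat_dvd_iff_le hpos.ne').1 ?_)
      rw [← h]
      exact Nat.gcd_dvd_left _ _
    · exact Nat.dvd_gcd pow_padicValNat_dvd (pow_dvd_pow p hM)
  have hker : ∀ x : Eˣ, (∃ k, x ^ p ^ k = 1) ↔ x ^ p ^ N = 1 := by
    intro x
    refine ⟨?_, fun h => ⟨N, h⟩⟩
    rintro ⟨k, hk⟩
    have h1 : orderOf x ∣ (Nat.card Eˣ).gcd (p ^ max k N) :=
      Nat.dvd_gcd (orderOf_dvd_natCard x)
        ((orderOf_dvd_of_pow_eq_one hk).trans (pow_dvd_pow p (le_max_left _ _)))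
    rw [hgcd _ (hN.trans (le_max_right _ _)), ← hgcd N hN] at h1
    exact orderOf_dvd_iff_pow_eq_one.1 (h1.trans (Nat.gcd_dvd_right _ _))
  have h1 := card_primaryHom_eq (p := p) (G := Eˣ) (s + 1) (N := N) fun x hx => (hker x).1 hx
  rw [Nat.card_congr (primaryHomEquiv (s + 1))] at h1
  have h2 : Nat.card (primaryTuples p (s + 1 - 1) Eˣ) =
      Nat.card Eˣ * (pPart p (Nat.card E - 1)) ^ s := by
    have e : primaryTuples p (s + 1 - 1) Eˣ ≃ Eˣ × (Fin s → (powMonoidHom (p ^ N) : Eˣ →* Eˣ).ker) :=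
      { toFun := fun x => (x.1.1, fun i => ⟨x.1.2 i, (hker _).1 (x.2.1 i)⟩)
        invFun := fun x => ⟨(x.1, fun i => x.2 i), fun i => (hker _).2 (x.2 i).2,
          fun i => Commute.all _ _, fun i j => Commute.all _ _⟩
        left_inv := fun _ => rfl
        right_inv := fun _ => rfl }
    rw [Nat.card_congr e, Nat.card_prod, Nat.card_fun, Nat.card_fin, IsCyclic.card_powMonoidHom_ker,
      hgcd N hN]
  have h3 : Nat.card (Σ z : Eˣ, {f : Multiplicative (Fin (s + 1 - 1) → ZMod (p ^ N)) →* Eˣ //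
      ∀ a, z * f a * z⁻¹ = f a}) =
      Nat.card Eˣ * Nat.card (Multiplicative (Fin s → ZMod (p ^ N)) →* Eˣ) := by
    rw [← Nat.card_prod]
    exact Nat.card_congr ⟨fun x => (x.1, x.2.1), fun x => ⟨x.1, x.2, fun a => by
      rw [mul_comm x.1, mul_inv_cancel_right]⟩, fun _ => rfl, fun _ => rfl⟩
  rw [h2, h3] at h1
  exact (Nat.eq_of_mul_eq_mul_left hpos h1).symm

end AlgHomCount

/-! ### The differential equations of the two weight series -/

noncomputable section HomWeightRecursion

open PowerSeries

attribute [local instance] conjHomAction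

theorem pow_prime_pow_eq_one_of_padicValNat_le {p : ℕ} [hp : Fact p.Prime] {G : Type*} [Group G]
    [Finite G] {N : ℕ} (hN : padicValNat p (Nat.card G) ≤ N) {x : G}
    (hx : ∃ k, x ^ p ^ k = 1) : x ^ p ^ N = 1 := by
  obtain ⟨k, hk⟩ := hx
  obtain ⟨j, -, hj⟩ := (Nat.dvd_prime_pow hp.out).1 (orderOf_dvd_of_pow_eq_one hk)
  refine orderOf_dvd_iff_pow_eq_one.1 ?_
  rw [hj]
  refine pow_dvd_pow p (le_trans ?_ hN)
  rw [← padicValNat_dvd_iff_le Nat.card_pos.ne', ← hj]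
  exact orderOf_dvd_natCard x

/-- The weights `((|F| ^ k - 1)_p) ^ (r - 1)` governing the representations over `F`. -/
def unitWeights (p r Q : ℕ) : PowerSeries ℚ :=
  PowerSeries.mk fun k => if k = 0 then 0 else (pPart p (Q ^ k - 1) : ℚ) ^ (r - 1)

theorem card_monoidAlgebra_algHom {p : ℕ} [hp : Fact p.Prime] {F E : Type*} [Field F] [Field E]
    [Finite E] [Algebra F E] (s : ℕ) {N : ℕ} (hN : padicValNat p (Nat.card E - 1) ≤ N) :
    Nat.card (MonoidAlgebra F (Multiplicative (Fin s → ZMod (p ^ N))) →ₐ[F] E) =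
      pPart p (Nat.card E - 1) ^ s := by
  rw [← card_hom_unit_eq s hN, ← Nat.card_congr (MonoidAlgebra.lift F E _)]
  refine Nat.card_congr
    { toFun := fun f => f.toHomUnits
      invFun := fun f => (Units.coeHom E).comp f
      left_inv := fun f => by ext; rfl
      right_inv := fun f => by ext; rfl }

theorem homWeight_eq_card {p : ℕ} [hp : Fact p.Prime] (r : ℕ) {F : Type*} [Field F] [Finite F]
    {N n : ℕ} (hN : padicValNat p (Nat.card ((Fin n → F) ≃ₗ[F] (Fin n → F))) ≤ N)
    [NeZero (Nat.card (Multiplicative (Fin (r - 1) → ZMod (p ^ N))) : F)]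
    [Fintype (MaximalSpectrum (MonoidAlgebra F (Multiplicative (Fin (r - 1) → ZMod (p ^ N)))))] :
    homWeight p r F (Fin n → F) =
      Nat.card {m : MaximalSpectrum
          (MonoidAlgebra F (Multiplicative (Fin (r - 1) → ZMod (p ^ N)))) → ℕ //
        ∑ I, m I * simpleDegree F _ I = n} := by
  have : NeZero (p ^ N) := ⟨pow_ne_zero _ hp.out.ne_zero⟩
  have : Finite (Multiplicative (Fin (r - 1) → ZMod (p ^ N))) :=
    inferInstanceAs (Finite (Fin (r - 1) → ZMod (p ^ N)))
  rw [homWeight, card_primaryHom_eq_card_orbits r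
    fun x hx => pow_prime_pow_eq_one_of_padicValNat_le hN hx, card_orbits_eq,
    Nat.cast_mul, mul_div_cancel_right₀ _ (Nat.cast_ne_zero.2 Nat.card_pos.ne')]
  simp only [Module.finrank_fin_fun]

theorem X_mul_derivative_homWeight (p : ℕ) [hp : Fact p.Prime] (r : ℕ) (F : Type*) [Field F]
    [Finite F] {l : ℕ} [hl : Fact l.Prime] (hpl : p ≠ l) [CharP F l] :
    X * d⁄dX ℚ (PowerSeries.mk fun n => homWeight p r F (Fin n → F)) =
      unitWeights p r (Nat.card F) * PowerSeries.mk fun n => homWeight p r F (Fin n → F) := by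
  ext n
  -- No single `N` serves all degrees, so the identity is proved one coefficient at a time. The
  -- first summand bounds the exponent of the `p`-elements of `GL_k(F)`, the second that of the
  -- `p`-power roots of unity in the extension of degree `k`, for all `k ≤ n`.
  let v : ℕ → ℕ := fun k => padicValNat p (Nat.card ((Fin k → F) ≃ₗ[F] (Fin k → F))) +
    padicValNat p (Nat.card F ^ k - 1)
  let N := ∑ k ∈ Finset.range (n + 1), v k
  have hv : ∀ k ≤ n, v k ≤ N := fun k hk =>
    Finset.single_le_sum (f := v) (fun _ _ => Nat.zero_le _)
      (Finset.mem_range.2 (Nat.lt_succ_of_le hk))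
  have : NeZero (p ^ N) := ⟨pow_ne_zero _ hp.out.ne_zero⟩
  let H := Multiplicative (Fin (r - 1) → ZMod (p ^ N))
  have : Finite H := inferInstanceAs (Finite (Fin (r - 1) → ZMod (p ^ N)))
  have hH : Nat.card H = (p ^ N) ^ (r - 1) := by
    change Nat.card (Fin (r - 1) → ZMod (p ^ N)) = _
    rw [Nat.card_fun, Nat.card_fin, Nat.card_zmod]
  have : NeZero (Nat.card H : F) := ⟨by
    rw [hH, Ne, CharP.cast_eq_zero_iff F l]
    exact fun h => hpl ((Nat.prime_dvd_prime_iff_eq hl.out hp.out).1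
      (hl.out.dvd_of_dvd_pow (hl.out.dvd_of_dvd_pow h))).symm⟩
  have : Module.Finite F (MonoidAlgebra F H) := inferInstance
  have : Finite (MonoidAlgebra F H) := Module.finite_of_finite F
  have : Fintype (MaximalSpectrum (MonoidAlgebra F H)) := Fintype.ofFinite _
  have hd : ∀ I, 0 < simpleDegree F (MonoidAlgebra F H) I := fun I => Module.finrank_pos
  have hE : ∀ j ≤ n, homWeight p r F (Fin j → F) =
      Nat.card {m : MaximalSpectrum (MonoidAlgebra F H) → ℕ //
        ∑ I, m I * simpleDegree F _ I = j} := fun j hj =>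
    homWeight_eq_card r ((Nat.le_add_right _ _).trans (hv j hj))
  have hT : ∀ k ≤ n, k ≠ 0 → ((∑ I, if simpleDegree F (MonoidAlgebra F H) I ∣ k then
      simpleDegree F (MonoidAlgebra F H) I else 0 : ℕ) : ℚ) =
        (pPart p (Nat.card F ^ k - 1) : ℚ) ^ (r - 1) := by
    intro k hk hk0
    have : NeZero k := ⟨hk0⟩
    have h := sum_simpleDegree_eq_card_algHom (F := F) (R := MonoidAlgebra F H)
      (E := FiniteField.Extension F l k)
    rw [FiniteField.finrank_extension] at h
    rw [h, card_monoidAlgebra_algHom, FiniteField.natCard_extension, Nat.cast_pow]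
    rw [FiniteField.natCard_extension]
    exact (Nat.le_add_left _ _).trans (hv k hk)
  -- Only coefficients of index at most `n` enter here, and for these the finite group `H` gives the
  -- correct weights.
  have key := congrArg (coeff n) (X_mul_derivative_weightedCount hd)
  rw [coeff_mul] at key ⊢
  rw [coeff_mul] at key ⊢
  convert key using 1
  · refine Finset.sum_congr rfl fun x hx => ?_
    obtain ⟨a, b⟩ := x
    replace hx := Finset.HasAntidiagonal.mem_antidiagonal.1 hx
    by_cases ha : a = 1
    · simp only [coeff_derivative, coeff_mk]
      rw [hE (b + 1) (by simp only at hx; omega)]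
    · simp [coeff_X, ha]
  · refine Finset.sum_congr rfl fun x hx => ?_
    obtain ⟨a, b⟩ := x
    replace hx := Finset.HasAntidiagonal.mem_antidiagonal.1 hx
    simp only at hx
    simp only [unitWeights, coeff_mk]
    rw [hE b (by omega)]
    split_ifs with ha
    · simp
    · rw [hT a (by omega) ha]

theorem homWeight_zero (p : ℕ) [hp : Fact p.Prime] (r : ℕ) (F : Type*) [Field F] :
    homWeight p r F (Fin 0 → F) = 1 := by
  have : Unique ((Fin 0 → F) ≃ₗ[F] (Fin 0 → F)) :=
    ⟨⟨LinearEquiv.refl F _⟩, fun _ => LinearEquiv.ext fun x => funext fun i => i.elim0⟩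
  have : Unique (PrimaryHom p r ((Fin 0 → F) ≃ₗ[F] (Fin 0 → F))) :=
    ⟨⟨1⟩, fun f => MonoidHom.ext fun x => Subsingleton.elim _ _⟩
  simp [homWeight]

theorem charWeight_zero (p : ℕ) [hp : Fact p.Prime] (r : ℕ) (F : Type*) [Field F] :
    charWeight p r F (Fin 0 → F) = 1 := by
  have : Unique ((Fin 0 → F) ≃ₗ[F] (Fin 0 → F)) :=
    ⟨⟨LinearEquiv.refl F _⟩, fun _ => LinearEquiv.ext fun x => funext fun i => i.elim0⟩
  have : Unique (PrimaryHom p r ((Fin 0 → F) ≃ₗ[F] (Fin 0 → F))) :=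
    ⟨⟨1⟩, fun f => MonoidHom.ext fun x => Subsingleton.elim _ _⟩
  simp [charWeight, charSum, equivariantChar, finsum_unique]

theorem X_mul_derivative_charWeight (p : ℕ) [hp : Fact p.Prime] (r : ℕ) (F : Type*) [Field F]
    [Finite F] {l : ℕ} [hl : Fact l.Prime] (hpl : p ≠ l) [CharP F l] :
    X * d⁄dX ℚ (PowerSeries.mk fun n => charWeight p r F (Fin n → F)) =
      -unitWeights p r (Nat.card F) * PowerSeries.mk fun n => charWeight p r F (Fin n → F) := by
  have hE : constantCoeff (PowerSeries.mk fun n => homWeight p r F (Fin n → F)) = 1 := by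
    rw [← coeff_zero_eq_constantCoeff_apply, coeff_mk, homWeight_zero]
  have h : (PowerSeries.mk fun n => charWeight p r F (Fin n → F)) =
      (PowerSeries.mk fun n => homWeight p r F (Fin n → F))⁻¹ := by
    rw [PowerSeries.eq_inv_iff_mul_eq_one (by simp [hE])]
    ext n
    rw [coeff_mul, coeff_one, Finset.Nat.sum_antidiagonal_eq_sum_range_succ_mk]
    simp only [coeff_mk]
    split_ifs with hn
    · subst hn
      simp [homWeight_zero, charWeight_zero]
    · exact sum_charWeight_mul_homWeight p r F hl.out hpl hn
  rw [h]
  exact X_mul_derivative_inv hE (X_mul_derivative_homWeight p r F hpl)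

end HomWeightRecursion

/-! ### From matrices to linear automorphisms -/

noncomputable section Matrices

/-- The identification of invertible matrices with linear automorphisms. -/
def generalLinearEquiv (F : Type*) [Field F] (n : ℕ) :
    GL (Fin n) F ≃* ((Fin n → F) ≃ₗ[F] (Fin n → F)) :=
  Matrix.GeneralLinearGroup.toLin.trans
    (LinearMap.GeneralLinearGroup.generalLinearEquiv F (Fin n → F))

theorem coe_generalLinearEquiv {F : Type*} [Field F] {n : ℕ} (g : GL (Fin n) F) :
    ((generalLinearEquiv F n g : (Fin n → F) ≃ₗ[F] (Fin n → F)) : (Fin n → F) →ₗ[F] (Fin n → F)) =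
      Matrix.mulVecLin (g : Matrix (Fin n) (Fin n) F) := by
  ext
  rfl

theorem primaryEulerChar_eq_charWeight (p : ℕ) [Fact p.Prime] (r : ℕ) {n : ℕ} (hn : n ≠ 0)
    (F : Type*) [Field F] [Finite F] :
    primaryEulerChar p r n F = charWeight p r F (Fin n → F) := by
  have : Finite (PrimaryHom p r ((Fin n → F) ≃ₗ[F] (Fin n → F))) := finite_primaryHom p r _
  have := Fintype.ofFinite (PrimaryHom p r ((Fin n → F) ≃ₗ[F] (Fin n → F)))
  have h : ∑ᶠ X : PrimaryHom p r (GL (Fin n) F),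
      (reducedEulerChar (fixedProperSubspaces F n (Set.range X)) : ℚ) =
      ∑ᶠ X : PrimaryHom p r ((Fin n → F) ≃ₗ[F] (Fin n → F)), (equivariantChar X : ℚ) := by
    refine finsum_eq_of_bijective _
      (MonoidHom.comp_mulEquiv_bijective (generalLinearEquiv F n)) fun X => ?_
    rw [equivariantChar, if_neg (by simpa using hn)]
    congr 1
    refine reducedEulerChar_congr
      { toEquiv := Equiv.subtypeEquivRight fun W => ?_, map_rel_iff' := Iff.rfl }
    change _ ∧ _ ∧ _ ↔ _ ∧ _ ∧ _
    refine and_congr_right fun _ => and_congr_right fun _ => ?_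
    rw [Set.forall_mem_range]
    refine forall_congr' fun a => ?_
    rw [← coe_generalLinearEquiv]
    rfl
  rw [primaryEulerChar, charWeight, charSum, h, Nat.card_congr (generalLinearEquiv F n).toEquiv,
    one_div, inv_mul_eq_div, finsum_eq_sum_of_fintype, finsum_eq_sum_of_fintype, Int.cast_sum]

theorem primaryGenFun_eq (p : ℕ) [Fact p.Prime] (r : ℕ) (F : Type*) [Field F] [Finite F] :
    primaryGenFun p r F = PowerSeries.mk fun n => charWeight p r F (Fin n → F) := by
  ext n
  rw [primaryGenFun, PowerSeries.coeff_mk, PowerSeries.coeff_mk]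
  split_ifs with hn
  · rw [hn, charWeight_zero]
  · exact primaryEulerChar_eq_charWeight p r hn F

theorem coeff_zero_primaryGenFun (p : ℕ) [Fact p.Prime] (r : ℕ) (F : Type*) [Field F] :
    PowerSeries.coeff 0 (primaryGenFun p r F) = 1 := by
  simp [primaryGenFun]

end Matrices

/-! ### Valuations of `q ^ (p ^ e * n) - 1` -/

section Valuations

/-- Fermat gives divisibility by `p`. Divisibility by `p ^ 2` would make the order `p (p - 1)` of
`g` divide `p - 1`. -/
theorem padicValNat_pow_sub_one_of_orderOf {p : ℕ} [hp : Fact p.Prime] {g : ℕ} (hg : 1 < g)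
    (hgp : orderOf (g : ZMod (p ^ 2)) = Nat.totient (p ^ 2)) :
    ¬p ∣ g ∧ padicValNat p (g ^ (p - 1) - 1) = 1 := by
  have hp1 : 1 < p := hp.out.one_lt
  have htot : Nat.totient (p ^ 2) = p * (p - 1) := by
    rw [Nat.totient_prime_pow hp.out two_pos, show 2 - 1 = 1 from rfl, pow_one]
  have hpg : ¬p ∣ g := by
    intro h
    have hfin : IsOfFinOrder (g : ZMod (p ^ 2)) := by
      rw [← orderOf_pos_iff, hgp, htot]
      exact Nat.mul_pos hp.out.pos (Nat.sub_pos_of_lt hp1)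
    have := (ZMod.isUnit_iff_coprime g (p ^ 2)).1 hfin.isUnit
    exact hp.out.one_lt.ne' (Nat.eq_one_of_dvd_coprimes this h (dvd_pow_self p two_ne_zero))
  refine ⟨hpg, ?_⟩
  have hpos : 1 < g ^ (p - 1) := Nat.one_lt_pow (Nat.sub_pos_of_lt hp1).ne' hg
  have hcast : ∀ m : ℕ, m ∣ g ^ (p - 1) - 1 ↔ (g : ZMod m) ^ (p - 1) = 1 := fun m => by
    rw [← ZMod.natCast_eq_zero_iff, Nat.cast_sub hpos.le, sub_eq_zero]
    push_cast
    rfl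
  have h1 : p ^ 1 ∣ g ^ (p - 1) - 1 := by
    rw [pow_one, hcast]
    exact ZMod.pow_card_sub_one_eq_one (by rwa [Ne, ZMod.natCast_eq_zero_iff])
  have h2 : ¬p ^ 2 ∣ g ^ (p - 1) - 1 := by
    rw [hcast, ← orderOf_dvd_iff_pow_eq_one, hgp, htot]
    intro h
    have := Nat.le_of_dvd (Nat.sub_pos_of_lt hp1) h
    nlinarith [Nat.sub_pos_of_lt hp1]
  rw [padicValNat_dvd_iff_le (Nat.sub_pos_of_lt hpos).ne'] at h1 h2
  omega

/-- Lifting the exponent, valid because `p` is odd and divides `q - 1`. -/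
theorem unitWeights_eq_primaryWeights {p : ℕ} [hp : Fact p.Prime] (hp2 : p ≠ 2) {q : ℕ}
    (hq : 1 < q) (hpq : ¬p ∣ q) (hv : padicValNat p (q - 1) = 1) (r e : ℕ) :
    unitWeights p r (q ^ p ^ e) = primaryWeights p (r - 1) e := by
  ext n
  rw [unitWeights, primaryWeights, PowerSeries.coeff_mk, PowerSeries.coeff_mk]
  split_ifs with hn
  · rfl
  have h := padicValNat.pow_sub_pow (hp.out.odd_of_ne_two hp2) hq
    (dvd_of_one_le_padicValNat hv.ge) hpq (mul_ne_zero (pow_ne_zero e hp.out.ne_zero) hn)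
  rw [one_pow, hv, padicValNat.mul (pow_ne_zero e hp.out.ne_zero) hn, padicValNat.prime_pow,
    pow_mul] at h
  rw [pPart, h, Nat.cast_pow, ← pow_mul, mul_comm, ← add_assoc]

theorem primaryWeights_eq_nsmul (p s e : ℕ) :
    primaryWeights p s e = ((p ^ (s * e) : ℕ) : PowerSeries ℚ) * primaryWeights p s 0 := by
  ext n
  rw [← nsmul_eq_mul, map_nsmul, primaryWeights, primaryWeights, PowerSeries.coeff_mk,
    PowerSeries.coeff_mk, nsmul_eq_mul]
  split_ifs with hn
  · simp
  · push_cast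
    rw [← pow_add]
    congr 1
    ring

end Valuations

/-! ### The differential equation of the generating function and its consequences -/

theorem X_mul_derivative_primaryGenFun {p : ℕ} [Fact p.Prime] (r : ℕ) {g : ℕ} (hg : g.Prime)
    (hpg : ¬p ∣ g) {F : Type*} [Field F] [Finite F] {k : ℕ} (hF : Nat.card F = g ^ k) :
    PowerSeries.X * PowerSeries.derivative ℚ (primaryGenFun p r F) =
      -unitWeights p r (Nat.card F) * primaryGenFun p r F := by
  have : Fact g.Prime := ⟨hg⟩
  have := Fintype.ofFinite F
  have : CharP F g := charP_of_card_eq_prime_pow (f := k) (by rw [← Nat.card_eq_fintype_card, hF])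
  rw [primaryGenFun_eq]
  exact X_mul_derivative_charWeight p r F fun h => hpg (h ▸ dvd_rfl)

theorem mainTheorem8 (p : ℕ) [Fact p.Prime] (hp : p ≠ 2)
    (g : ℕ) (hg : g.Prime)
    (hgp : orderOf (g : ZMod (p ^ 2)) = Nat.totient (p ^ 2))
    (q : ℕ) (hq : q = g ^ (p - 1))
    (r : ℕ) (hr : 1 ≤ r) (e : ℕ)
    (K : Type*) [Field K] [Finite K] (hK : Nat.card K = q)
    (L : Type*) [Field L] [Finite L] (hL : Nat.card L = q ^ p ^ e) :
    primaryGenFun p r L = primaryGenFun p r K ^ p ^ ((r - 1) * e) ∧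
    primaryGenFun p r L =
      seriesExp (-PowerSeries.mk fun n =>
        if n = 0 then (0 : ℚ) else (pPart p ((q ^ p ^ e) ^ n - 1) : ℚ) ^ (r - 1) / (n : ℚ)) ∧
    HasFormalProd
      (fun n => seriesPow
        ((1 - PowerSeries.X ^ p ^ n) ^ p * (1 - PowerSeries.X ^ p ^ (n + 1))⁻¹)
        ((p : ℚ) ^ (((r : ℤ) - 2) * ((n : ℤ) + 1) + ((r : ℤ) - 1) * (e : ℤ))))
      (primaryGenFun p r L) ∧
    ∀ n : ℕ, 1 ≤ n →
      ∃ m : ℤ, primaryEulerChar p r n L = ((p : ℚ) ^ ((r - 1) * (1 + e))) * (m : ℚ) := by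
  have hpp : p.Prime := Fact.out
  obtain ⟨hpg, hv⟩ := padicValNat_pow_sub_one_of_orderOf hg.one_lt hgp
  have hpq : ¬p ∣ q := fun h => hpg (hpp.dvd_of_dvd_pow (hq ▸ h))
  have hq1 : 1 < q := hq ▸ Nat.one_lt_pow (Nat.sub_pos_of_lt hpp.one_lt).ne' hg.one_lt
  rw [← hq] at hv
  have hdK := X_mul_derivative_primaryGenFun r hg hpg (hK.trans hq)
  have hdL := X_mul_derivative_primaryGenFun r hg hpg (k := (p - 1) * p ^ e) (F := L)
    (by rw [hL, hq, pow_mul])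
  have hdL' := hdL
  have hK' : Nat.card K = q ^ p ^ 0 := by rw [hK, pow_zero, pow_one]
  rw [hK', unitWeights_eq_primaryWeights hp hq1 hpq hv] at hdK
  rw [hL, unitWeights_eq_primaryWeights hp hq1 hpq hv] at hdL'
  rw [hL] at hdL
  have h0 := coeff_zero_primaryGenFun p r L
  refine ⟨?_, eq_seriesExp_of_X_mul_derivative h0 hdL, fun m => ?_, fun n hn => ?_⟩
  -- The weights for `L` are `p ^ ((r - 1) * e)` times those for `K`, and multiplying a logarithmic
  -- derivative by a natural number corresponds to taking that power.
  · refine eq_of_X_mul_derivative hdL' ?_ (by rw [map_neg, coeff_zero_primaryWeights, neg_zero]) ?_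
    · rw [X_mul_derivative_pow hdK, primaryWeights_eq_nsmul p (r - 1) e, mul_neg]
    · simp [primaryGenFun]
  · filter_upwards [Filter.eventually_ge_atTop (Finset.range (m + 1))] with S hS
    rw [← coeff_prod_primaryFactor h0 hdL' hS]
    refine congrArg _ (Finset.prod_congr rfl fun n _ => ?_)
    -- With `s = r - 1`, where `r ≥ 1` makes the truncated subtraction exact, `s - 1` is the integer
    -- `r - 2`, which is negative for `r = 1`.
    rw [Nat.cast_sub hr, Nat.cast_one, sub_sub, one_add_one_eq_two]
    rfl
  · obtain ⟨z, hz⟩ := exists_coeff_eq_of_X_mul_derivative h0 hdL' (Nat.one_le_iff_ne_zero.1 hn)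
    refine ⟨z, ?_⟩
    rw [← hz, primaryGenFun, PowerSeries.coeff_mk, if_neg (Nat.one_le_iff_ne_zero.1 hn)]
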